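/- Let $M$ be a monoid and $S\subseteq M$ a generating subset with $1\in S$; write $S_+=S\setminus\{1\}$, and write $e$ for $1$ regarded as a letter of $S$. Let $\operatorname{ev}:S^*\to M$ be the evaluation map, $\pi_e:S^*\to S_+^*$ the map deleting all letters $e$, and $|f|$ the minimal length of an $S$-word representing $f\in M$. A \emph{factorisation map} is a map $\eta=(\eta',\overline\eta):M\to M^2$ with $\eta(1)=(1,1)$ such that $\eta'(f)\,\overline\eta(f)=f$ and $|f|=|\eta'(f)|+|\overline\eta(f)|$ for all $f$, and $\eta'(f)\in S_+$ for $f\neq1$. It is a \emph{factorability structure} if, with $F(f,g)=\eta(fg)$ and $F_i$ denoting $F$ applied to the entries $i,i+1$ of a tuple, on every triple in $M^3$ the maps $F_1F_2F_1F_2$, $F_2F_1F_2$, $F_2F_1F_2F_1$ coincide or each of them strictly reduces the sum of the lengths of the entries. A \emph{quadratic normalisation mod $e$ for $M$} is a length-preserving map $N:S^*\to S^*$ with $N(s)=s$ for $s\in S$ and $N(u|v|w)=N(u|N(v)|w)$ for all words $u,v,w$, such that: $N(w|e)=N(e|w)=N(w)|e$ for all $w$; $M=\langle S\mid \{w=N(w)\mid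 w\in S^*\}\cup\{e=1\}\rangle$ via the inclusion $S\subseteq M$; a word $w$ is normal ($N(w)=w$) if and only if all its length-two factors are normal; and $N(w)$ is obtained from each $w$ by finitely many applications of the restriction $\overline N$ of $N$ to length-two factors. The \emph{weak domino rule} is valid for $\overline N$ if, whenever $\overline N(t_0|s_1)=s_1'|t_1$, $\overline N(t_1|s_2)=s_2'|t_2$ and $s_1|s_2$, $s_1'|t_1$, $s_2'|t_2$ are fixed by $\overline N$, then $s_1'|s_2'$ is fixed by $\overline N$ or $e\in\{s_1',s_2',t_2\}$. For $\varphi:S^2\to S^2$ let $N_\varphi:S^*\to S^*$ be defined by recursion: $N_\varphi$ of the empty word is empty; $N_\varphi(w)=N_\varphi(\pi_e(w))$ if $w$ contains $e$; and otherwise, for $n\ge1$, if $u$ is obtained from $s_1|N_\varphi(s_2|\cdots|s_n)$ by applying $\varphi$ at the positions $1,2,3,\ldots$ successively up to the end of the word, then $N_\varphi(s_1|\cdots|s_n)$ is $u$ if $u$ contains no $e$, and $N_\varphi(u)$ otherwise. To a factorability structure $\eta$ associate the map $N^{\eta}(w)=N_\varphi(w)|e^{|w|-|N_\varphi(w)|}$,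 where $\varphi(s,t)=\eta(st)$ on $S^2$ (which takes values in $S^2$). To a quadratic normalisation $N$ mod $e$ for $M$ satisfying the weak domino rule associate the map $\eta_N$ with $\eta_N(1)=(1,1)$ and $\eta_N(f)=(s_1,\operatorname{ev}(s_2|\cdots|s_n))$ if $f\ne1$ and $N_{\overline N}(w)=s_1|\cdots|s_n$, where $w$ is any $S$-word representing $f$. Then the following hold. (1) $\eta_N$ is well defined (independent of the choice of $w$). The assignments $\eta\mapsto N^{\eta}$ and $N\mapsto\eta_N$ are mutually inverse bijections between the set of factorability structures on $(M,S)$ and the set of quadratic normalisations mod $e$ for $M$ (on the alphabet $S$) for which the weak domino rule is valid. (2) Let $\eta$ be a factorability structure and $N=N^\eta$. The normal forms agree: for every $f\in M$ and every $S$-word $w$ representing $f$, the $\eta$-normal form $\operatorname{nf}_\eta(f)=\eta_{|f|-1}\cdots\eta_2\eta_1(f)$ (the empty word for $f=1$; $\eta_i$ is $\eta$ applied to the $i$th entry) equals $\pi_e(N(w))$. (3) Let $\eta$ be a factorability structure and $N=N^\eta$. Let $R_\eta$ be the rewriting system on $S_+$ with the rules $s|t\to\eta(st)$, letters $1$ being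 deleted from the target, for $s,t\in S_+$ with $\eta(st)\neq(s,t)$. Then $R_\eta$ is equal to the system on $S_+$ with the rules $s|t\to\pi_e(\overline N(s|t))$ for $s,t\in S_+$ with $s|t$ not normal. Let $R_N$ be the length-preserving system on $S$ with the rules $s|t\to\overline N(s|t)$ for $s,t\in S$ with $s|t$ not normal. The rules of $R_N$ are exactly the rules $e|s\to s|e$ ($s\in S_+$) and the rules $u\to v|e^{|u|-|v|}$ for the rules $u\to v$ of $R_\eta$. Every $R_N$-step $x\to y$ satisfies $\pi_e(x)=\pi_e(y)$ or is projected by $\pi_e$ to an $R_\eta$-step; and for $x,y\in S_+^*$, $x$ rewrites to $y$ under $R_\eta$ if and only if $x$ rewrites to $y|e^{|x|-|y|}$ under $R_N$ (where $|x|-|y|$ is read as $0$ if $|x|<|y|$). -/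

import Mathlib

namespace FactNorm

/-! Words over an alphabet `A` are lists. -/

section Words

variable {A : Type*}

/-- `F` applied to the two consecutive letters in positions `i`, `i + 1` (positions are counted
from `0`); words that are too short are left unchanged. -/
def applyAt (F : A × A → A × A) : ℕ → List A → List A
  | 0, a :: b :: l => (F (a, b)).1 :: (F (a, b)).2 :: l
  | i + 1, a :: l => a :: applyAt F i l
  | _, l => l

/-- `F` applied successively at all the positions in `u`, the first entry of `u` first. -/
def applySeq (F : A × A → A × A) (u : List ℕ) (w : List A) : List A :=
  u.foldl (fun v i => applyAt F i v) w

/-- One sweep from left to right through the word `a :: l`. -/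
def sweepFrom (φ : A × A → A × A) : A → List A → List A
  | a, [] => [a]
  | a, b :: l => (φ (a, b)).1 :: sweepFrom φ (φ (a, b)).2 l

/-- The composite `φ_{n-1} ⋯ φ_2 φ_1` on words of length `n` (`φ_1` is applied first). -/
def sweep (φ : A × A → A × A) : List A → List A
  | [] => []
  | a :: l => sweepFrom φ a l

theorem length_sweepFrom (φ : A × A → A × A) (a : A) (l : List A) :
    (sweepFrom φ a l).length = l.length + 1 := by
  induction l generalizing a with
  | nil => rfl
  | cons b l ih => simp [sweepFrom, ih]

/-- The sweep is the composite of the maps `φ_i`. -/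
theorem sweep_eq_applySeq (φ : A × A → A × A) (w : List A) :
    sweep φ w = applySeq φ (List.range (w.length - 1)) w := by
  cases w with
  | nil => rfl
  | cons a l =>
    induction l generalizing a with
    | nil => rfl
    | cons b l ih =>
      have key : ∀ (u : List ℕ) (x : A) (v : List A),
          applySeq φ (u.map (· + 1)) (x :: v) = x :: applySeq φ u v := by
        intro u
        induction u with
        | nil => intro x v; rfl
        | cons i u ihu => intro x v; exact ihu x (applyAt φ i v)
      have h := ih (φ (a, b)).2
      simp only [sweep, List.length_cons, Nat.add_sub_cancel] at h ⊢
      rw [List.range_succ_eq_map]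
      change (φ (a, b)).1 :: sweepFrom φ (φ (a, b)).2 l
        = applySeq φ ((List.range l.length).map (· + 1)) ((φ (a, b)).1 :: (φ (a, b)).2 :: l)
      rw [key, h]

open Classical in
/-- The word with all the occurrences of `e` removed, as a word over `A`. -/
noncomputable def erase (e : A) (w : List A) : List A :=
  w.filter (fun a => a ≠ e)

theorem length_erase_lt {e : A} {w : List A} (h : e ∈ w) :
    (erase e w).length < w.length := by
  classical
  unfold erase
  rw [List.length_filter_lt_length_iff_exists]
  exact ⟨e, h, by simp⟩

theorem length_erase_le (e : A) (w : List A) : (erase e w).length ≤ w.length :=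
  List.length_filter_le _ _

theorem not_mem_erase (e : A) (w : List A) : e ∉ erase e w := by
  simp [erase]

open Classical in
/-- The normalisation map associated to `φ`, together with the bound on its length that makes
the recursion well-founded. -/
noncomputable def normMapAux (e : A) (φ : A × A → A × A) :
    (w : List A) → {l : List A // l.length ≤ w.length}
  | [] => ⟨[], le_rfl⟩
  | s :: t =>
    if h : e ∈ s :: t then
      ⟨(normMapAux e φ (erase e (s :: t))).1,
        (normMapAux e φ (erase e (s :: t))).2.trans (length_erase_le e _)⟩
    else
      let v := normMapAux e φ t
      let u := sweep φ (s :: v.1)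
      have hu : u.length ≤ (s :: t).length := by
        have h1 : u.length = v.1.length + 1 := length_sweepFrom φ s v.1
        have h2 := v.2
        simp only [List.length_cons]
        omega
      if h' : e ∈ u then
        ⟨(normMapAux e φ (erase e u)).1,
          (normMapAux e φ (erase e u)).2.trans ((length_erase_le e _).trans hu)⟩
      else ⟨u, hu⟩
termination_by w => w.length
decreasing_by
  all_goals first
    | exact length_erase_lt h
    | exact lt_of_lt_of_le (length_erase_lt h') hu
    | simp

/-- The normalisation map `N_φ` associated to `φ : A² → A²`, where `e` is the distinguished
letter of `A`. It is characterised by the four equations proved below. -/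
noncomputable def normMap (e : A) (φ : A × A → A × A) (w : List A) : List A :=
  (normMapAux e φ w).1

theorem normMap_nil (e : A) (φ : A × A → A × A) : normMap e φ [] = [] := by
  rw [normMap, normMapAux]

theorem normMap_of_mem {e : A} (φ : A × A → A × A) {w : List A} (h : e ∈ w) :
    normMap e φ w = normMap e φ (erase e w) := by
  cases w with
  | nil => simp at h
  | cons s t =>
    conv_lhs => rw [normMap, normMapAux]
    rw [dif_pos h, normMap]

theorem normMap_cons {e : A} (φ : A × A → A × A) {s : A} {t : List A} (h : e ∉ s :: t)
    (h' : e ∉ sweep φ (s :: normMap e φ t)) :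
    normMap e φ (s :: t) = sweep φ (s :: normMap e φ t) := by
  conv_lhs => rw [normMap, normMapAux]
  rw [dif_neg h]
  exact congrArg Subtype.val (dif_neg h')

theorem normMap_cons_of_mem {e : A} (φ : A × A → A × A) {s : A} {t : List A} (h : e ∉ s :: t)
    (h' : e ∈ sweep φ (s :: normMap e φ t)) :
    normMap e φ (s :: t) = normMap e φ (sweep φ (s :: normMap e φ t)) := by
  rw [normMap_of_mem φ h']
  conv_lhs => rw [normMap, normMapAux]
  rw [dif_neg h]
  exact congrArg Subtype.val (dif_pos h')

/-- The length-preserving extended form `N'_φ(w) = N_φ(w) | e^m`, `m = |w| - |N_φ(w)|`. -/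
noncomputable def extNormMap (e : A) (φ : A × A → A × A) (w : List A) : List A :=
  normMap e φ w ++ List.replicate (w.length - (normMap e φ w).length) e

/-! Normalisations. -/

/-- `(A, N)` is a normalisation. -/
structure IsNormalisation (N : List A → List A) : Prop where
  length_eq : ∀ w, (N w).length = w.length
  letter : ∀ a, N [a] = [a]
  absorb : ∀ u v w, N (u ++ v ++ w) = N (u ++ N v ++ w)

/-- The restriction `N̄` of `N` to words of length two, as a map `A² → A²`. (As `N` preserves
lengths, the second case does not occur for a normalisation.) -/
def restrictTwo (N : List A → List A) (p : A × A) : A × A :=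
  match N [p.1, p.2] with
  | [x, y] => (x, y)
  | _ => p

/-- A normalisation `(A, N)` is quadratic. -/
structure IsQuadratic (N : List A → List A) : Prop where
  normal_iff : ∀ w, N w = w ↔ ∀ x a b y, w = x ++ [a, b] ++ y → N [a, b] = [a, b]
  exists_seq : ∀ w, ∃ u : List ℕ, N w = applySeq (restrictTwo N) u w

/-- The letter `e` is `N`-neutral. -/
def IsNeutral (e : A) (N : List A → List A) : Prop :=
  ∀ w, N (w ++ [e]) = N w ++ [e] ∧ N (e :: w) = N w ++ [e]

/-- The weak domino rule is valid for `F`: the conclusion of the domino rule may fail only if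
the upper right part `s₁'`, `s₂'`, `t₂` of the diagram contains `e`. -/
def WeakDomino (e : A) (F : A × A → A × A) : Prop :=
  ∀ s₁ s₂ s₁' s₂' t₀ t₁ t₂ : A,
    F (t₀, s₁) = (s₁', t₁) → F (t₁, s₂) = (s₂', t₂) →
    F (s₁, s₂) = (s₁, s₂) → F (s₁', t₁) = (s₁', t₁) → F (s₂', t₂) = (s₂', t₂) →
    F (s₁', s₂') = (s₁', s₂') ∨ s₁' = e ∨ s₂' = e ∨ t₂ = e

/-! Rewriting systems: the set of rules is a binary relation on words. -/

/-- There is a rewriting step from `x` to `y`. -/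
def Step (R : List A → List A → Prop) (x y : List A) : Prop :=
  ∃ w w' u v, R u v ∧ x = w ++ u ++ w' ∧ y = w ++ v ++ w'

/-- `x` rewrites to `y` in finitely many (possibly zero) steps. -/
def Rewrites (R : List A → List A → Prop) : List A → List A → Prop :=
  Relation.ReflTransGen (Step R)

/-- The alphabet without the letter `e`. -/
abbrev Plus (e : A) : Type _ := {a : A // a ≠ e}

open Classical in
/-- The projection `π_e : A^* → A₊^*` removing all the occurrences of `e`. -/
noncomputable def proj (e : A) (w : List A) : List (Plus e) :=
  w.filterMap (fun a => if h : a ≠ e then some ⟨a, h⟩ else none)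

/-- The inclusion of `A₊^*` in `A^*`. -/
def incl {e : A} (w : List (Plus e)) : List A := w.map Subtype.val

/-- The length-preserving rewriting system on `A` associated to `N`:
`s|t → N̄(s|t)` for all `s`, `t` in `A` such that `s|t` is not `N`-normal. -/
def quadRules (N : List A → List A) (u v : List A) : Prop :=
  ∃ s t : A, u = [s, t] ∧ N [s, t] ≠ [s, t] ∧ v = N [s, t]

/-- The rewriting system on `A₊` associated to `N`:
`s|t → π_e(N̄(s|t))` for all `s`, `t` in `A₊` such that `s|t` is not `N`-normal. -/
def quadRulesMod (e : A) (N : List A → List A) (u v : List (Plus e)) : Prop :=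
  ∃ s t : Plus e, u = [s, t] ∧ N [s.1, t.1] ≠ [s.1, t.1] ∧ v = proj e (N [s.1, t.1])

end Words

section Monoids

variable {M : Type*} [Monoid M]

/-- `S` is a generating subset of `M` which contains the identity element. -/
structure IsGenerating (S : Set M) : Prop where
  one_mem : (1 : M) ∈ S
  closure_eq : Submonoid.closure S = ⊤

/-- The letter `e`, that is, the identity element regarded as a letter. -/
def IsGenerating.e {S : Set M} (hS : IsGenerating S) : S := ⟨1, hS.one_mem⟩

/-- The evaluation of words. -/
def ev {S : Set M} (w : List S) : M := (w.map Subtype.val).prod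

theorem IsGenerating.exists_word {S : Set M} (hS : IsGenerating S) (f : M) :
    ∃ w : List S, ev w = f := by
  have hf : f ∈ Submonoid.closure S := by rw [hS.closure_eq]; trivial
  induction hf using Submonoid.closure_induction with
  | mem x hx => exact ⟨[⟨x, hx⟩], by simp [ev]⟩
  | one => exact ⟨[], by simp [ev]⟩
  | mul x y _ _ hx hy =>
    obtain ⟨u, rfl⟩ := hx
    obtain ⟨v, rfl⟩ := hy
    exact ⟨u ++ v, by simp [ev]⟩

/-- The length `|f|`: the minimal length of an `S`-word representing `f`. -/
noncomputable def len (S : Set M) (f : M) : ℕ :=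
  sInf {n | ∃ w : List S, ev w = f ∧ w.length = n}

/-! Factorability structures. -/

/-- `η = (η', η̄)` is a factorisation map on `(M, S)`. -/
structure IsFactorisationMap (S : Set M) (η : M → M × M) : Prop where
  mem : ∀ f, f ≠ 1 → (η f).1 ∈ S ∧ (η f).1 ≠ 1
  mul_eq : ∀ f, (η f).1 * (η f).2 = f
  geodesic : ∀ f, len S ((η f).1 * (η f).2) = len S (η f).1 + len S (η f).2
  one : η 1 = (1, 1)

/-- `F` applied to the first two entries of a triple. -/
def triple₁ (F : M × M → M × M) (x : M × M × M) : M × M × M :=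
  ((F (x.1, x.2.1)).1, (F (x.1, x.2.1)).2, x.2.2)

/-- `F` applied to the last two entries of a triple. -/
def triple₂ (F : M × M → M × M) (x : M × M × M) : M × M × M :=
  (x.1, F (x.2.1, x.2.2))

/-- The sum of the lengths of the entries of a triple. -/
noncomputable def lenSum (S : Set M) (x : M × M × M) : ℕ :=
  len S x.1 + len S x.2.1 + len S x.2.2

/-- The map `F = η ∘ μ`. -/
def etaMul (η : M → M × M) (p : M × M) : M × M := η (p.1 * p.2)

/-- `η` is a factorability structure on `(M, S)`. -/
structure IsFactorabilityStructure (S : Set M) (η : M → M × M) : Prop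
    extends IsFactorisationMap S η where
  triples : ∀ x : M × M × M,
    let F₁ := triple₁ (etaMul η)
    let F₂ := triple₂ (etaMul η)
    (F₁ (F₂ (F₁ (F₂ x))) = F₂ (F₁ (F₂ x)) ∧ F₂ (F₁ (F₂ x)) = F₂ (F₁ (F₂ (F₁ x)))) ∨
    (lenSum S (F₁ (F₂ (F₁ (F₂ x)))) < lenSum S x ∧
      lenSum S (F₂ (F₁ (F₂ x))) < lenSum S x ∧
      lenSum S (F₂ (F₁ (F₂ (F₁ x)))) < lenSum S x)

theorem len_ev_le {S : Set M} (w : List S) : len S (ev w) ≤ w.length :=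
  Nat.sInf_le ⟨w, rfl, rfl⟩

theorem exists_word_len {S : Set M} (hS : IsGenerating S) (f : M) :
    ∃ w : List S, ev w = f ∧ w.length = len S f := by
  obtain ⟨w, hw⟩ := hS.exists_word f
  exact Nat.sInf_mem (s := {n | ∃ w : List S, ev w = f ∧ w.length = n}) ⟨_, w, hw, rfl⟩

theorem IsFactorisationMap.fst_mem {S : Set M} (hS : IsGenerating S) {η : M → M × M}
    (h : IsFactorisationMap S η) (f : M) : (η f).1 ∈ S := by
  by_cases hf : f = 1
  · subst hf
    rw [h.one]
    exact hS.one_mem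
  · exact (h.mem f hf).1

theorem IsFactorisationMap.snd_mem {S : Set M} (hS : IsGenerating S) {η : M → M × M}
    (h : IsFactorisationMap S η) (s t : S) : (η (s.1 * t.1)).2 ∈ S := by
  by_cases hf : s.1 * t.1 = 1
  · rw [hf, h.one]
    exact hS.one_mem
  · have h1 : len S (s.1 * t.1) ≤ 2 := by
      have := len_ev_le [s, t]
      simpa [ev] using this
    have h2 := h.geodesic (s.1 * t.1)
    rw [h.mul_eq] at h2
    have h3 : len S (η (s.1 * t.1)).1 ≠ 0 := by
      intro h0
      obtain ⟨w, hw, hl⟩ := exists_word_len hS (η (s.1 * t.1)).1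
      rw [h0, List.length_eq_zero_iff] at hl
      subst hl
      exact (h.mem _ hf).2 hw.symm
    obtain ⟨w, hw, hl⟩ := exists_word_len hS (η (s.1 * t.1)).2
    match w, hw, hl with
    | [], hw, _ =>
      rw [← hw]
      exact hS.one_mem
    | [a], hw, _ =>
      rw [← hw]
      simp [ev]
    | _ :: _ :: _, _, hl =>
      simp only [List.length_cons] at hl
      omega

/-- The local factorability structure of `η`: the restriction of `η ∘ μ` to `S²`. -/
def localMap {S : Set M} (hS : IsGenerating S) {η : M → M × M}
    (h : IsFactorabilityStructure S η) (p : S × S) : S × S :=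
  (⟨(etaMul η (p.1.1, p.2.1)).1, h.fst_mem hS _⟩,
    ⟨(etaMul η (p.1.1, p.2.1)).2, h.snd_mem hS p.1 p.2⟩)

/-- The normalisation map `N'_φ` corresponding to a factorability structure `η`, where `φ` is
the local factorability structure of `η`. -/
noncomputable def normOfFact {S : Set M} (hS : IsGenerating S) {η : M → M × M}
    (h : IsFactorabilityStructure S η) : List S → List S :=
  extNormMap hS.e (localMap hS h)

/-- A word `s₁|⋯|s_n` is split into `s₁` and the evaluation of `s₂|⋯|s_n`. -/
def splitHead {S : Set M} : List S → M × M
  | [] => (1, 1)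
  | s :: l => (s.1, ev l)

open Classical in
/-- The map `η` constructed from `φ : S² → S²`: `η(1) = (1, 1)`, and
`η(f) = (s₁, ev(s₂|⋯|s_n))` if `N_φ(w) = s₁|⋯|s_n`, with `w` an `S`-word representing `f`. -/
noncomputable def factOfLocal {S : Set M} (hS : IsGenerating S) (φ : S × S → S × S) (f : M) :
    M × M :=
  if f = 1 then (1, 1) else splitHead (normMap hS.e φ (hS.exists_word f).choose)

/-- The map `η_N` corresponding to a quadratic normalisation `N`. -/
noncomputable def factOfNorm {S : Set M} (hS : IsGenerating S) (N : List S → List S) :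
    M → M × M :=
  factOfLocal hS (restrictTwo N)

/-- The relations `w = N(w)`, for all words `w`, and `e = 1`. -/
def normRel {S : Set M} (hS : IsGenerating S) (N : List S → List S)
    (u v : FreeMonoid S) : Prop :=
  v = FreeMonoid.ofList (N u.toList) ∨ (u = FreeMonoid.of hS.e ∧ v = 1)

/-- `(S, N)` is a quadratic normalisation mod `e` for the monoid `M`; the isomorphism is the
one induced by the inclusion of `S` in `M`. -/
structure IsQuadNormMod {S : Set M} (hS : IsGenerating S) (N : List S → List S) : Prop where
  isNormalisation : IsNormalisation N
  isQuadratic : IsQuadratic N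
  isNeutral : IsNeutral hS.e N
  presents : ∃ Ψ : PresentedMonoid (normRel hS N) ≃* M,
    ∀ s : S, Ψ (PresentedMonoid.of (normRel hS N) s) = s.1

/-- `η` applied to the entry in position `i` (counted from `0`), which is thereby replaced by
two entries. -/
def expandAt (η : M → M × M) : ℕ → List M → List M
  | 0, f :: l => (η f).1 :: (η f).2 :: l
  | i + 1, f :: l => f :: expandAt η i l
  | _, [] => []

open Classical in
/-- The normal form `nf_η(f) = η_{|f|-1} ⋯ η_2 η_1 (f)` with respect to `η`; the normal form
of `1` is the empty word. -/
noncomputable def nfFact (S : Set M) (η : M → M × M) (f : M) : List M :=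
  if f = 1 then [] else (List.range (len S f - 1)).foldl (fun w i => expandAt η i w) [f]

open Classical in
/-- The rewriting system on `S₊` associated to a factorability structure `η`:
`s|t → η(st)`, with `1` removed from the target, for all `s`, `t` in `S₊` such that `(s, t)` is
not stable. -/
def factRules {S : Set M} (hS : IsGenerating S) (η : M → M × M)
    (u v : List (Plus hS.e)) : Prop :=
  ∃ s t : Plus hS.e, u = [s, t] ∧ etaMul η (s.1.1, t.1.1) ≠ (s.1.1, t.1.1) ∧
    v.map (fun a => a.1.1) =
      [(etaMul η (s.1.1, t.1.1)).1, (etaMul η (s.1.1, t.1.1)).2].filter (fun x => x ≠ 1)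

end Monoids

end FactNorm

/-! Both structures are encoded by the same data: a map `φ : S² → S²` satisfying
`IsLocalFactorability`. Such a `φ` moves `e` to the right, is idempotent, preserves products and
obeys the weak domino rule; moreover two `e`-free words with all length-two factors `φ`-fixed
("normal words") that evaluate to the same element are equal.

Given such a `φ`, the weak domino rule makes each sweep of a normal word normal unless a letter `e`
appears, and then erasing shortens the word. So `normMap` reaches the unique normal word of an
element, and that word is geodesic (`len_ev`). Consequently `extNormMap` depends only on evaluation
and length, which yields the axioms of a normalisation almost at once.

The passage from `η` to `φ` gets uniqueness from `splitHead_eq`: cutting off the head of a normal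
word computes `η`. The passage from `N` to `φ` gets it from a congruence containing the defining
relations of the presentation (`ev_apply_and_erase_eq`).

The hard direction is from `φ` back to factorability. A triple whose total length survives `F₂F₁F₂`
must be geodesic, and `F₂F₁F₂` then returns the first two heads of its product and the remainder.
This recognition principle rests on `factOfLocal_mul_mul`, an induction along a geodesic word for
the first entry. -/

namespace FactNorm

/-! ### Normal words and the recursion for `normMap` -/

section Words

variable {A : Type*}

/-- The pair `(a, b)` is fixed by `φ`. -/
def Stable (φ : A × A → A × A) (a b : A) : Prop := φ (a, b) = (a, b)

/-- The word `w` does not contain `e`, and all its factors of length two are fixed by `φ`. -/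
def IsNormalWord (e : A) (φ : A × A → A × A) (w : List A) : Prop :=
  e ∉ w ∧ w.IsChain (Stable φ)

/-- The rules `s|t → φ(s, t)`. -/
def pairRules (φ : A × A → A × A) (u v : List A) : Prop :=
  ∃ p : A × A, u = [p.1, p.2] ∧ v = [(φ p).1, (φ p).2]

theorem erase_append (e : A) (u v : List A) : erase e (u ++ v) = erase e u ++ erase e v := by
  simp [erase]

theorem erase_cons_self (e : A) (u : List A) : erase e (e :: u) = erase e u := by
  simp [erase]

theorem erase_cons_of_ne {e a : A} (h : a ≠ e) (u : List A) :
    erase e (a :: u) = a :: erase e u := by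
  simp [erase, h]

theorem erase_of_not_mem {e : A} {u : List A} (h : e ∉ u) : erase e u = u := by
  unfold erase
  rw [List.filter_eq_self]
  intro a ha
  have : a ≠ e := fun h' => h (h' ▸ ha)
  simp [this]

theorem erase_replicate (e : A) (k : ℕ) : erase e (List.replicate k e) = [] := by
  simp [erase]

theorem erase_append_replicate {e : A} {u : List A} (h : e ∉ u) (k : ℕ) :
    erase e (u ++ List.replicate k e) = u := by
  rw [erase_append, erase_of_not_mem h, erase_replicate, List.append_nil]

theorem length_normMap_le (e : A) (φ : A × A → A × A) (w : List A) :
    (normMap e φ w).length ≤ w.length :=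
  (normMapAux e φ w).2

theorem length_extNormMap (e : A) (φ : A × A → A × A) (w : List A) :
    (extNormMap e φ w).length = w.length := by
  have := length_normMap_le e φ w
  simp only [extNormMap, List.length_append, List.length_replicate]
  omega

theorem length_sweep (φ : A × A → A × A) (w : List A) : (sweep φ w).length = w.length := by
  cases w with
  | nil => rfl
  | cons a l => exact length_sweepFrom φ a l

/-- Induction along the recursion that defines `normMap`. -/
theorem normMap_induction {e : A} {φ : A × A → A × A} {P : List A → List A → Prop}
    (nil : P [] [])
    (mem : ∀ w r, e ∈ w → P (erase e w) r → P w r)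
    (cons : ∀ s t v, e ∉ s :: t → v.length ≤ t.length → P t v → e ∉ sweep φ (s :: v) →
      P (s :: t) (sweep φ (s :: v)))
    (cons_mem : ∀ s t v r, e ∉ s :: t → v.length ≤ t.length → P t v → e ∈ sweep φ (s :: v) →
      P (erase e (sweep φ (s :: v))) r → P (s :: t) r)
    (w : List A) : P w (normMap e φ w) := by
  induction hn : w.length using Nat.strong_induction_on generalizing w with
  | _ n ih =>
    subst hn
    by_cases hw : e ∈ w
    · rw [normMap_of_mem φ hw]
      exact mem _ _ hw (ih _ (length_erase_lt hw) _ rfl)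
    · cases w with
      | nil => rw [normMap_nil]; exact nil
      | cons s t =>
        have ht := ih t.length (by simp) t rfl
        have hl := length_normMap_le e φ t
        by_cases hs : e ∈ sweep φ (s :: normMap e φ t)
        · rw [normMap_cons_of_mem φ hw hs, normMap_of_mem φ hs]
          refine cons_mem s t _ _ hw hl ht hs (ih _ ?_ _ rfl)
          have h1 := length_erase_lt hs
          rw [length_sweep] at h1
          simp only [List.length_cons] at h1 ⊢
          omega
        · rw [normMap_cons φ hw hs]
          exact cons s t _ hw hl ht hs

/-! ### Rewriting steps and moving `e` to the end -/

section Rewriting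

variable {R : List A → List A → Prop}

theorem Step.append_left {x y : List A} (h : Step R x y) (z : List A) :
    Step R (z ++ x) (z ++ y) := by
  obtain ⟨w, w', u, v, hR, rfl, rfl⟩ := h
  exact ⟨z ++ w, w', u, v, hR, by simp, by simp⟩

theorem Step.append_right {x y : List A} (h : Step R x y) (z : List A) :
    Step R (x ++ z) (y ++ z) := by
  obtain ⟨w, w', u, v, hR, rfl, rfl⟩ := h
  exact ⟨w, w' ++ z, u, v, hR, by simp, by simp⟩

theorem Rewrites.append_left {x y : List A} (h : Rewrites R x y) (z : List A) :
    Rewrites R (z ++ x) (z ++ y) :=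
  Relation.ReflTransGen.lift (z ++ ·) (fun _ _ h => Step.append_left h z) _ _ h

theorem Rewrites.append_right {x y : List A} (h : Rewrites R x y) (z : List A) :
    Rewrites R (x ++ z) (y ++ z) :=
  Relation.ReflTransGen.lift (· ++ z) (fun _ _ h => Step.append_right h z) _ _ h

theorem Rewrites.trans {x y z : List A} (h : Rewrites R x y) (h' : Rewrites R y z) :
    Rewrites R x z :=
  Relation.ReflTransGen.trans h h'

theorem Rewrites.of_rule {u v : List A} (h : R u v) : Rewrites R u v :=
  Relation.ReflTransGen.single ⟨[], [], u, v, h, by simp, by simp⟩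

/-- If `e|s → s|e` are rules, then the letter `e` can be moved to the end of a word. -/
theorem rewrites_cons_append {e : A} (hR : ∀ s, s ≠ e → R [e, s] [s, e]) (l : List A) :
    Rewrites R (e :: l) (l ++ [e]) := by
  induction l with
  | nil => exact .refl
  | cons b l ih =>
    have h2 : Rewrites R (b :: e :: l) (b :: (l ++ [e])) := ih.append_left [b]
    by_cases hb : b = e
    · subst hb
      exact h2
    · exact (Rewrites.append_right (.of_rule (hR b hb)) l).trans h2

theorem rewrites_erase_append_replicate {e : A} (hR : ∀ s, s ≠ e → R [e, s] [s, e])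
    (w : List A) :
    Rewrites R w (erase e w ++ List.replicate (w.length - (erase e w).length) e) := by
  induction w with
  | nil => exact .refl
  | cons a w ih =>
    have h1 := length_erase_le e w
    have h2 := ih.append_left [a]
    by_cases ha : a = e
    · subst ha
      rw [erase_cons_self, List.length_cons,
        Nat.sub_add_comm h1, List.replicate_succ', ← List.append_assoc]
      exact h2.trans (rewrites_cons_append hR _)
    · rw [erase_cons_of_ne ha]
      simpa using h2

end Rewriting

theorem rewrites_sweepFrom (φ : A × A → A × A) (a : A) (l : List A) :
    Rewrites (pairRules φ) (a :: l) (sweepFrom φ a l) := by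
  induction l generalizing a with
  | nil => exact .refl
  | cons b l ih =>
    have h1 : Rewrites (pairRules φ) [a, b] [(φ (a, b)).1, (φ (a, b)).2] :=
      .of_rule ⟨(a, b), rfl, rfl⟩
    exact (h1.append_right l).trans ((ih _).append_left [_])

/-- Both ingredients of the recursion, sweeping and erasing, are realised by applications of `φ`:
erased letters are instead carried to the end, where they form the padding. This is what supplies
the finite sequence of positions in `IsQuadratic`. -/
theorem rewrites_extNormMap {e : A} {φ : A × A → A × A} (he : ∀ s, φ (e, s) = (s, e))
    (w : List A) : Rewrites (pairRules φ) w (extNormMap e φ w) := by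
  have hR : ∀ s, s ≠ e → pairRules φ [e, s] [s, e] := fun s _ => ⟨(e, s), rfl, by simp [he]⟩
  have main : (normMap e φ w).length ≤ w.length ∧ Rewrites (pairRules φ) w
      (normMap e φ w ++ List.replicate (w.length - (normMap e φ w).length) e) := by
    -- Erasure costs nothing in the padded form: the erased letters are parked at the end while the
    -- rest is rewritten in front of them.
    have glue : ∀ (x r : List A), r.length ≤ (erase e x).length →
        Rewrites (pairRules φ) (erase e x)
          (r ++ List.replicate ((erase e x).length - r.length) e) →
        Rewrites (pairRules φ) x (r ++ List.replicate (x.length - r.length) e) := by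
      intro x r hr hx
      have h1 := length_erase_le e x
      have h2 := (rewrites_erase_append_replicate hR x).trans (hx.append_right _)
      rw [List.append_assoc, List.replicate_append_replicate] at h2
      convert h2 using 3
      omega
    refine normMap_induction (P := fun w r => r.length ≤ w.length ∧ Rewrites (pairRules φ) w
      (r ++ List.replicate (w.length - r.length) e)) ?_ ?_ ?_ ?_ w
    · exact ⟨le_rfl, .refl⟩
    · rintro w r - ⟨h1, h2⟩
      exact ⟨h1.trans (length_erase_le e w), glue w r h1 h2⟩
    · rintro s t v - hl ⟨-, h2⟩ -
      rw [length_sweep]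
      refine ⟨by simpa using hl, ?_⟩
      have h3 := h2.append_left [s]
      have h4 := (rewrites_sweepFrom φ s v).append_right (List.replicate (t.length - v.length) e)
      simpa [sweep] using Rewrites.trans h3 h4
    · rintro s t v r - hl ⟨-, h2⟩ - ⟨h3, h4⟩
      have h5 := length_erase_le e (sweep φ (s :: v))
      rw [length_sweep] at h5
      simp only [List.length_cons] at h5 ⊢
      refine ⟨by omega, ?_⟩
      have h6 := h2.append_left [s]
      have h7 := (rewrites_sweepFrom φ s v).append_right (List.replicate (t.length - v.length) e)
      have h8 := (h6.trans h7).trans ((glue _ r h3 h4).append_right _)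
      rw [List.append_assoc, List.replicate_append_replicate, length_sweep] at h8
      simp only [List.length_cons] at h8
      rwa [show v.length + 1 - r.length + (t.length - v.length) = t.length + 1 - r.length by
        omega] at h8
  exact main.2

theorem applyAt_length_append (φ : A × A → A × A) (u v : List A) (p : A × A) :
    applyAt φ u.length (u ++ [p.1, p.2] ++ v) = u ++ [(φ p).1, (φ p).2] ++ v := by
  induction u with
  | nil => rfl
  | cons a u ih =>
    change a :: applyAt φ u.length (u ++ [p.1, p.2] ++ v) = _
    rw [ih]
    rfl

theorem Rewrites.exists_applySeq {φ : A × A → A × A} {x y : List A}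
    (h : Rewrites (pairRules φ) x y) : ∃ u : List ℕ, y = applySeq φ u x := by
  induction h with
  | refl => exact ⟨[], rfl⟩
  | tail _ h ih =>
    obtain ⟨u, rfl⟩ := ih
    obtain ⟨w, w', _, _, ⟨p, rfl, rfl⟩, h1, rfl⟩ := h
    refine ⟨u ++ [w.length], ?_⟩
    rw [← applyAt_length_append, ← h1]
    simp [applySeq]

/-! ### Sweeps and normality -/

theorem mem_sweepFrom_self {e : A} {φ : A × A → A × A} (he : ∀ s, φ (e, s) = (s, e))
    (l : List A) : e ∈ sweepFrom φ e l := by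
  induction l with
  | nil => simp [sweepFrom]
  | cons b l ih => simp [sweepFrom, he, ih]

/-- Each pair of consecutive outputs is the top of a domino diagram. The exceptional cases all put
`e` into the swept word: two of them as an output letter, and the third as the carried letter, which
`φ` then transports to the end. -/
theorem isChain_sweepFrom {e : A} {φ : A × A → A × A} (he : ∀ s, φ (e, s) = (s, e))
    (idem : ∀ p, φ (φ p) = φ p) (domino : WeakDomino e φ) {l : List A}
    (hl : l.IsChain (Stable φ)) (a : A) (h : e ∉ sweepFrom φ a l) :
    (sweepFrom φ a l).IsChain (Stable φ) := by
  induction l generalizing a with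
  | nil => simp [sweepFrom]
  | cons b l ih =>
    cases l with
    | nil => exact List.isChain_pair.2 (idem (a, b))
    | cons c l =>
      have h1 := ih hl.tail _ (fun h' => h (List.mem_cons_of_mem _ h'))
      simp only [sweepFrom, List.isChain_cons_cons, List.mem_cons, not_or] at hl h h1 ⊢
      refine ⟨?_, h1⟩
      rcases domino b c _ _ a _ _ rfl rfl hl.1 (idem _) (idem _) with h2 | h2 | h2 | h2
      · exact h2
      · exact absurd h2.symm h.1
      · exact absurd h2.symm h.2.1
      · exact absurd (h2 ▸ mem_sweepFrom_self he l) h.2.2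

theorem isNormalWord_sweep {e : A} {φ : A × A → A × A} (he : ∀ s, φ (e, s) = (s, e))
    (idem : ∀ p, φ (φ p) = φ p) (domino : WeakDomino e φ) {v : List A}
    (hv : IsNormalWord e φ v) (s : A) (h : e ∉ sweep φ (s :: v)) :
    IsNormalWord e φ (sweep φ (s :: v)) :=
  ⟨h, isChain_sweepFrom he idem domino hv.2 s h⟩

/-- A word with stable factors of length two is a normal word followed by letters `e`. -/
theorem exists_eq_append_replicate {e : A} {φ : A × A → A × A} (he : ∀ s, φ (e, s) = (s, e))
    {w : List A} (hw : w.IsChain (Stable φ)) :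
    ∃ v k, IsNormalWord e φ v ∧ w = v ++ List.replicate k e := by
  -- Since `φ (e, b) = (b, e)`, a fixed pair starting with `e` can only be `(e, e)`.
  have key : ∀ l : List A, (e :: l).IsChain (Stable φ) → ∃ k, l = List.replicate k e := by
    intro l
    induction l with
    | nil => exact fun _ => ⟨0, rfl⟩
    | cons b l ih =>
      intro h
      rw [List.isChain_cons_cons] at h
      have hb : b = e := by simpa [he] using congrArg Prod.fst h.1
      subst hb
      obtain ⟨k, rfl⟩ := ih h.2
      exact ⟨k + 1, rfl⟩
  induction w with
  | nil => exact ⟨[], 0, ⟨by simp, by simp⟩, rfl⟩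
  | cons a l ih =>
    by_cases ha : a = e
    · subst ha
      obtain ⟨k, rfl⟩ := key l hw
      exact ⟨[], k + 1, ⟨by simp, by simp⟩, rfl⟩
    · obtain ⟨v, k, h1, rfl⟩ := ih hw.tail
      refine ⟨a :: v, k, ⟨?_, ?_⟩, rfl⟩
      · simp only [List.mem_cons, not_or]
        exact ⟨fun h => ha h.symm, h1.1⟩
      · exact List.IsChain.left_of_append (l₂ := List.replicate k e) (by simpa using hw)

theorem IsNormalWord.tail {e : A} {φ : A × A → A × A} {a : A} {l : List A}
    (h : IsNormalWord e φ (a :: l)) : IsNormalWord e φ l :=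
  ⟨fun h' => h.1 (List.mem_cons_of_mem _ h'), h.2.tail⟩

/-- Length preservation excludes the default branch of `restrictTwo`. -/
theorem restrictTwo_eq_iff {N : List A → List A} (hN : ∀ w, (N w).length = w.length)
    (p q : A × A) : restrictTwo N p = q ↔ N [p.1, p.2] = [q.1, q.2] := by
  have h := hN [p.1, p.2]
  unfold restrictTwo
  match hw : N [p.1, p.2], h with
  | [x, y], _ => simp [Prod.ext_iff]

end Words

/-! ### Word length in the monoid -/

section Length

variable {M : Type*} [Monoid M] {S : Set M}

@[simp] theorem ev_nil : ev ([] : List S) = 1 := rfl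

@[simp] theorem ev_cons (s : S) (l : List S) : ev (s :: l) = s.1 * ev l := by simp [ev]

@[simp] theorem ev_append (u v : List S) : ev (u ++ v) = ev u * ev v := by simp [ev]

@[simp] theorem ev_replicate (hS : IsGenerating S) (k : ℕ) :
    ev (List.replicate k hS.e) = 1 := by
  simp [ev, IsGenerating.e]

@[simp] theorem ev_erase (hS : IsGenerating S) (w : List S) : ev (erase hS.e w) = ev w := by
  induction w with
  | nil => simp [erase]
  | cons a w ih =>
    by_cases ha : a = hS.e
    · subst ha
      rw [erase_cons_self, ih, ev_cons]
      simp [IsGenerating.e]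
    · rw [erase_cons_of_ne ha, ev_cons, ev_cons, ih]

theorem len_one : len S (1 : M) = 0 := by
  have := len_ev_le ([] : List S)
  simpa using this

theorem len_eq_zero (hS : IsGenerating S) {f : M} (h : len S f = 0) : f = 1 := by
  obtain ⟨w, rfl, hl⟩ := exists_word_len hS f
  rw [h, List.length_eq_zero_iff] at hl
  simp [hl]

theorem len_le_one (s : S) : len S s.1 ≤ 1 := by
  have := len_ev_le [s]
  simpa using this

theorem len_le_one_of_mem {f : M} (hf : f ∈ S) : len S f ≤ 1 := len_le_one ⟨f, hf⟩

theorem len_eq_one (hS : IsGenerating S) {f : M} (hf : f ∈ S) (h : f ≠ 1) : len S f = 1 := by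
  have h1 := len_le_one_of_mem hf
  have h2 : len S f ≠ 0 := fun h' => h (len_eq_zero hS h')
  omega

theorem len_mul_le (hS : IsGenerating S) (f g : M) : len S (f * g) ≤ len S f + len S g := by
  obtain ⟨u, rfl, hu⟩ := exists_word_len hS f
  obtain ⟨v, rfl, hv⟩ := exists_word_len hS g
  rw [← ev_append, ← hu, ← hv, ← List.length_append]
  exact len_ev_le _

theorem ne_one_of_ne_e {hS : IsGenerating S} {s : S} (h : s ≠ hS.e) : s.1 ≠ 1 :=
  fun h' => h (Subtype.ext h')

/-- The properties of a map `φ : S² → S²` that make it the local form of a factorability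
structure. -/
structure IsLocalFactorability (hS : IsGenerating S) (φ : S × S → S × S) : Prop where
  one_left : ∀ s, φ (hS.e, s) = (s, hS.e)
  idem : ∀ p, φ (φ p) = φ p
  mul_eq : ∀ p, ((φ p).1 * (φ p).2 : M) = p.1 * p.2
  weakDomino : WeakDomino hS.e φ
  unique : ∀ u v, IsNormalWord hS.e φ u → IsNormalWord hS.e φ v → ev u = ev v → u = v

theorem ev_sweepFrom {φ : S × S → S × S} (h : ∀ p, ((φ p).1 * (φ p).2 : M) = p.1 * p.2)
    (a : S) (l : List S) : ev (sweepFrom φ a l) = a * ev l := by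
  induction l generalizing a with
  | nil => simp [sweepFrom]
  | cons b l ih => rw [sweepFrom, ev_cons, ih, ← mul_assoc, h, ev_cons, mul_assoc]

/-! ### From local data to a quadratic normalisation -/

namespace IsLocalFactorability

variable {hS : IsGenerating S} {φ : S × S → S × S}

theorem isNormalWord_normMap (h : IsLocalFactorability hS φ) (w : List S) :
    IsNormalWord hS.e φ (normMap hS.e φ w) ∧ ev (normMap hS.e φ w) = ev w := by
  refine normMap_induction (P := fun w r => IsNormalWord hS.e φ r ∧ ev r = ev w) ?_ ?_ ?_ ?_ w
  · exact ⟨⟨by simp, by simp⟩, rfl⟩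
  · rintro w r - ⟨h1, h2⟩
    exact ⟨h1, by simpa using h2⟩
  · rintro s t v - - ⟨h1, h2⟩ hs
    refine ⟨isNormalWord_sweep h.one_left h.idem h.weakDomino h1 s hs, ?_⟩
    rw [sweep, ev_sweepFrom h.mul_eq, h2, ev_cons]
  · rintro s t v r - - ⟨-, h2⟩ - ⟨h3, h4⟩
    refine ⟨h3, ?_⟩
    rw [h4, ev_erase, sweep, ev_sweepFrom h.mul_eq, h2, ev_cons]

theorem normMap_eq_of_ev_eq (h : IsLocalFactorability hS φ) {w u : List S}
    (hu : IsNormalWord hS.e φ u) (he : ev w = ev u) : normMap hS.e φ w = u := by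
  obtain ⟨h1, h2⟩ := h.isNormalWord_normMap w
  exact h.unique _ _ h1 hu (h2.trans he)

theorem normMap_congr (h : IsLocalFactorability hS φ) {w u : List S} (he : ev w = ev u) :
    normMap hS.e φ w = normMap hS.e φ u := by
  obtain ⟨h1, h2⟩ := h.isNormalWord_normMap u
  exact h.normMap_eq_of_ev_eq h1 (he.trans h2.symm)

/-- A geodesic word for the same element normalises to `u`, and `normMap` never lengthens. -/
theorem len_ev (h : IsLocalFactorability hS φ) {u : List S} (hu : IsNormalWord hS.e φ u) :
    len S (ev u) = u.length := by
  obtain ⟨w, hw, hl⟩ := exists_word_len hS (ev u)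
  refine le_antisymm (len_ev_le u) ?_
  have := length_normMap_le hS.e φ w
  rwa [h.normMap_eq_of_ev_eq hu hw, hl] at this

/-- The main tool for verifying the axioms: an identity between values of `extNormMap` reduces to
comparing evaluations and lengths. -/
theorem extNormMap_congr (h : IsLocalFactorability hS φ) {w u : List S} (he : ev w = ev u)
    (hl : w.length = u.length) : extNormMap hS.e φ w = extNormMap hS.e φ u := by
  rw [extNormMap, extNormMap, h.normMap_congr he, hl]

theorem ev_extNormMap (h : IsLocalFactorability hS φ) (w : List S) :
    ev (extNormMap hS.e φ w) = ev w := by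
  rw [extNormMap, ev_append, ev_replicate, mul_one, (h.isNormalWord_normMap w).2]

theorem extNormMap_eq_self (h : IsLocalFactorability hS φ) {w : List S}
    (hw : w.IsChain (Stable φ)) : extNormMap hS.e φ w = w := by
  obtain ⟨v, k, hv, rfl⟩ := exists_eq_append_replicate h.one_left hw
  rw [extNormMap, h.normMap_eq_of_ev_eq hv (by simp)]
  simp

theorem extNormMap_pair (h : IsLocalFactorability hS φ) (p : S × S) :
    extNormMap hS.e φ [p.1, p.2] = [(φ p).1, (φ p).2] := by
  rw [← h.extNormMap_eq_self (List.isChain_pair.2 (h.idem p))]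
  exact h.extNormMap_congr (by simpa using (h.mul_eq p).symm) rfl

theorem restrictTwo_extNormMap (h : IsLocalFactorability hS φ) :
    restrictTwo (extNormMap hS.e φ) = φ := by
  funext p
  rw [restrictTwo_eq_iff (length_extNormMap _ _), h.extNormMap_pair]

/-- The words `s|e` and `e|s` have equal evaluation and length, so `φ` agrees on them. -/
theorem one_right (h : IsLocalFactorability hS φ) (s : S) : φ (s, hS.e) = (s, hS.e) := by
  have h1 : extNormMap hS.e φ [s, hS.e] = extNormMap hS.e φ [hS.e, s] :=
    h.extNormMap_congr (by simp [IsGenerating.e]) rfl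
  rw [h.extNormMap_pair (s, hS.e), h.extNormMap_pair (hS.e, s), h.one_left] at h1
  simp only [List.cons.injEq, and_true] at h1
  exact Prod.ext h1.1 h1.2

theorem isChain_append_replicate (h : IsLocalFactorability hS φ) {u : List S}
    (hu : u.IsChain (Stable φ)) (k : ℕ) :
    (u ++ List.replicate k hS.e).IsChain (Stable φ) := by
  rw [List.isChain_append]
  refine ⟨hu, ?_, ?_⟩
  · exact List.isChain_replicate_of_rel k (h.one_right _)
  · intro x _ y hy
    have hy' : y = hS.e := List.eq_of_mem_replicate (List.mem_of_mem_head? hy)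
    subst hy'
    exact h.one_right x

theorem isChain_extNormMap (h : IsLocalFactorability hS φ) (w : List S) :
    (extNormMap hS.e φ w).IsChain (Stable φ) :=
  h.isChain_append_replicate (h.isNormalWord_normMap w).1.2 _

theorem isNormalisation_extNormMap (h : IsLocalFactorability hS φ) :
    IsNormalisation (extNormMap hS.e φ) where
  length_eq := length_extNormMap _ _
  letter a := h.extNormMap_eq_self (by simp)
  absorb u v w := h.extNormMap_congr (by simp [h.ev_extNormMap])
    (by simp [length_extNormMap])

theorem isQuadratic_extNormMap (h : IsLocalFactorability hS φ) :
    IsQuadratic (extNormMap hS.e φ) where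
  normal_iff w := by
    have h1 : extNormMap hS.e φ w = w ↔ w.IsChain (Stable φ) :=
      ⟨fun h' => h' ▸ h.isChain_extNormMap w, h.extNormMap_eq_self⟩
    have h2 : ∀ a b : S, extNormMap hS.e φ [a, b] = [a, b] ↔ Stable φ a b := by
      intro a b
      rw [h.extNormMap_pair (a, b), Stable, Prod.ext_iff]
      simp
    rw [h1, List.isChain_iff_forall_rel_of_append_cons_cons]
    simp only [h2]
    refine ⟨fun h' x a b y hw => h' (l₁ := x) (l₂ := y) (by simpa using hw),
      fun h' a b x y hw => h' x a b y (by simpa using hw)⟩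
  exists_seq w := by
    rw [h.restrictTwo_extNormMap]
    exact (rewrites_extNormMap h.one_left w).exists_applySeq

theorem isNeutral_extNormMap (h : IsLocalFactorability hS φ) :
    IsNeutral hS.e (extNormMap hS.e φ) := by
  intro w
  have h0 : extNormMap hS.e φ (hS.e :: w) = extNormMap hS.e φ (w ++ [hS.e]) :=
    h.extNormMap_congr (by simp [IsGenerating.e]) (by simp)
  have h1 : extNormMap hS.e φ (w ++ [hS.e]) = extNormMap hS.e φ w ++ [hS.e] := by
    rw [← h.extNormMap_eq_self (w := extNormMap hS.e φ w ++ [hS.e])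
      (h.isChain_append_replicate (h.isChain_extNormMap w) 1)]
    exact h.extNormMap_congr (by simp [h.ev_extNormMap]) (by simp [length_extNormMap])
  exact ⟨h1, h0.trans h1⟩

end IsLocalFactorability

/-- The evaluation of words as a homomorphism. -/
def evHom (S : Set M) : FreeMonoid S →* M := FreeMonoid.lift Subtype.val

theorem evHom_apply (w : FreeMonoid S) : evHom S w = ev w.toList := by
  simp [evHom, FreeMonoid.lift_apply, ev]

/-- Every class in the presented monoid contains the normal word of each of its members; with
uniqueness of normal words this gives injectivity of the evaluation. -/
theorem mk_eq_mk_normMap {hS : IsGenerating S} {φ : S × S → S × S} (w : List S) :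
    PresentedMonoid.mk (normRel hS (extNormMap hS.e φ)) (FreeMonoid.ofList w) =
      PresentedMonoid.mk (normRel hS (extNormMap hS.e φ))
        (FreeMonoid.ofList (normMap hS.e φ w)) := by
  set r := normRel hS (extNormMap hS.e φ)
  have h1 : PresentedMonoid.mk r (FreeMonoid.ofList w) =
      PresentedMonoid.mk r (FreeMonoid.ofList (extNormMap hS.e φ w)) :=
    PresentedMonoid.mk_eq_mk_of_rel (Or.inl rfl)
  have h2 : PresentedMonoid.mk r (FreeMonoid.of hS.e) = PresentedMonoid.mk r 1 :=
    PresentedMonoid.mk_eq_mk_of_rel (Or.inr ⟨rfl, rfl⟩)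
  have h3 : ∀ k, PresentedMonoid.mk r (FreeMonoid.ofList (List.replicate k hS.e)) = 1 := by
    intro k
    induction k with
    | zero => exact map_one _
    | succ k ih =>
      rw [List.replicate_succ, FreeMonoid.ofList_cons, map_mul, h2, ih, map_one, one_mul]
  rw [h1, extNormMap, FreeMonoid.ofList_append, map_mul, h3, mul_one]

theorem IsLocalFactorability.isQuadNormMod {hS : IsGenerating S} {φ : S × S → S × S}
    (h : IsLocalFactorability hS φ) : IsQuadNormMod hS (extNormMap hS.e φ) where
  isNormalisation := h.isNormalisation_extNormMap
  isQuadratic := h.isQuadratic_extNormMap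
  isNeutral := h.isNeutral_extNormMap
  presents := by
    set r := normRel hS (extNormMap hS.e φ) with hr
    have hrel : ∀ a b : FreeMonoid S, r a b → FreeMonoid.lift Subtype.val a =
        (FreeMonoid.lift Subtype.val b : M) := by
      intro a b hab
      change evHom S a = evHom S b
      rcases hab with rfl | ⟨rfl, rfl⟩
      · simp [evHom_apply, h.ev_extNormMap]
      · simp [evHom_apply, IsGenerating.e]
    have hmk : ∀ w : FreeMonoid S,
        PresentedMonoid.lift (Subtype.val : S → M) hrel (PresentedMonoid.mk r w) =
          ev w.toList := fun w => evHom_apply w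
    refine ⟨MulEquiv.ofBijective (PresentedMonoid.lift (Subtype.val : S → M) hrel) ⟨?_, ?_⟩, ?_⟩
    · intro x y hxy
      induction x using PresentedMonoid.inductionOn with | _ x
      induction y using PresentedMonoid.inductionOn with | _ y
      rw [hmk, hmk] at hxy
      have hx := mk_eq_mk_normMap (hS := hS) (φ := φ) x.toList
      have hy := mk_eq_mk_normMap (hS := hS) (φ := φ) y.toList
      rw [h.normMap_congr hxy] at hx
      exact hx.trans hy.symm
    · intro f
      obtain ⟨w, rfl⟩ := hS.exists_word f
      exact ⟨PresentedMonoid.mk r (FreeMonoid.ofList w), hmk _⟩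
    · intro s
      exact (hmk (FreeMonoid.of s)).trans (by simp)

end Length

/-! ### From a quadratic normalisation to local data -/

section QuadNorm

variable {M : Type*} [Monoid M] {S : Set M} {hS : IsGenerating S} {N : List S → List S}

namespace IsQuadNormMod

theorem pair_eq (h : IsQuadNormMod hS N) (p : S × S) :
    N [p.1, p.2] = [(restrictTwo N p).1, (restrictTwo N p).2] :=
  (restrictTwo_eq_iff h.isNormalisation.length_eq p _).1 rfl

theorem stable_iff (h : IsQuadNormMod hS N) (a b : S) :
    Stable (restrictTwo N) a b ↔ N [a, b] = [a, b] :=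
  restrictTwo_eq_iff h.isNormalisation.length_eq (a, b) (a, b)

theorem isChain_iff (h : IsQuadNormMod hS N) (w : List S) :
    w.IsChain (Stable (restrictTwo N)) ↔ N w = w := by
  rw [h.isQuadratic.normal_iff, List.isChain_iff_forall_rel_of_append_cons_cons]
  simp only [h.stable_iff]
  exact ⟨fun h' x a b y hw => h' (l₁ := x) (l₂ := y) (by simpa using hw),
    fun h' a b x y hw => h' x a b y (by simpa using hw)⟩

theorem apply_apply (h : IsQuadNormMod hS N) (w : List S) : N (N w) = N w := by
  simpa using (h.isNormalisation.absorb [] w []).symm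

theorem isChain_apply (h : IsQuadNormMod hS N) (w : List S) :
    (N w).IsChain (Stable (restrictTwo N)) :=
  (h.isChain_iff _).2 (h.apply_apply w)

/-- Evaluation is the image of a word under the presentation isomorphism. The first part applies the
relation `w = N(w)`; the second shows that `N`, up to letters `e`, is an invariant of the presented
monoid. -/
theorem ev_apply_and_erase_eq (h : IsQuadNormMod hS N) :
    (∀ w, ev (N w) = ev w) ∧
      ∀ u v, ev u = ev v → erase hS.e (N u) = erase hS.e (N v) := by
  obtain ⟨Ψ, hΨ⟩ := h.presents
  have hmk : ∀ w : List S,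
      Ψ (PresentedMonoid.mk (normRel hS N) (FreeMonoid.ofList w)) = ev w := by
    intro w
    induction w with
    | nil => simp
    | cons a w ih =>
      rw [FreeMonoid.ofList_cons, map_mul, map_mul, ih, ev_cons]
      exact congrArg (· * ev w) (hΨ a)
  refine ⟨fun w => ?_, fun u v huv => ?_⟩
  · rw [← hmk, ← hmk]
    exact congrArg Ψ (PresentedMonoid.mk_eq_mk_of_rel (Or.inl rfl)).symm
  · rw [← hmk, ← hmk] at huv
    have hcon := PresentedMonoid.mk_eq_mk_iff.1 (Ψ.injective huv)
    -- Quantifying over all contexts makes the relation compatible with products by construction.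
    let c : Con (FreeMonoid S) :=
      { r := fun u v => ∀ x y : List S, erase hS.e (N (x ++ u.toList ++ y)) =
          erase hS.e (N (x ++ v.toList ++ y))
        iseqv := ⟨fun _ _ _ => rfl, fun h x y => (h x y).symm,
          fun h h' x y => (h x y).trans (h' x y)⟩
        mul' := by
          intro u v u' v' h1 h2 x y
          have h3 := h1 x (u'.toList ++ y)
          have h4 := h2 (x ++ v.toList) y
          simp only [FreeMonoid.toList_mul, List.append_assoc] at h3 h4 ⊢
          exact h3.trans h4 }
    have hle : conGen (normRel hS N) ≤ c := by
      refine Con.conGen_le.2 ?_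
      rintro a b (rfl | ⟨rfl, rfl⟩) x y
      · exact congrArg (erase hS.e) (h.isNormalisation.absorb x a.toList y)
      -- Absorption and neutrality together give `N(x|e|y) = N(x|y)|e`, so inserting `e` anywhere is
      -- invisible after erasing.
      · have h1 := h.isNormalisation.absorb x (hS.e :: y) []
        have h2 := h.isNormalisation.absorb x y []
        rw [(h.isNeutral y).2] at h1
        simp only [List.append_nil] at h1 h2
        rw [← List.append_assoc, (h.isNeutral _).1, ← h2] at h1
        simp only [FreeMonoid.toList_of, FreeMonoid.toList_one, List.append_assoc,
          List.singleton_append, List.nil_append, h1, erase_append]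
        simp [erase]
    simpa using hle hcon [] []

theorem isLocalFactorability (h : IsQuadNormMod hS N)
    (hd : WeakDomino hS.e (restrictTwo N)) : IsLocalFactorability hS (restrictTwo N) where
  one_left s := by
    rw [restrictTwo_eq_iff h.isNormalisation.length_eq, (h.isNeutral [s]).2,
      h.isNormalisation.letter]
    rfl
  idem p := by
    rw [restrictTwo_eq_iff h.isNormalisation.length_eq, ← h.pair_eq, h.apply_apply]
  mul_eq p := by
    have h1 := h.ev_apply_and_erase_eq.1 [p.1, p.2]
    rw [h.pair_eq] at h1
    simpa using h1
  weakDomino := hd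
  unique u v hu hv huv := by
    have h1 := h.ev_apply_and_erase_eq.2 u v huv
    rwa [(h.isChain_iff u).1 hu.2, (h.isChain_iff v).1 hv.2, erase_of_not_mem hu.1,
      erase_of_not_mem hv.1] at h1

/-- The word `N w` has stable factors, hence is fixed by `extNormMap`, and it shares evaluation and
length with `w`. -/
theorem extNormMap_restrictTwo (h : IsQuadNormMod hS N)
    (hd : WeakDomino hS.e (restrictTwo N)) : extNormMap hS.e (restrictTwo N) = N := by
  have hl := h.isLocalFactorability hd
  funext w
  rw [← hl.extNormMap_eq_self (h.isChain_apply w)]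
  exact hl.extNormMap_congr (h.ev_apply_and_erase_eq.1 w).symm
    (h.isNormalisation.length_eq w).symm

end IsQuadNormMod

end QuadNorm

/-! ### From a factorability structure to local data -/

section Fact

variable {M : Type*} [Monoid M] {S : Set M} {hS : IsGenerating S} {η : M → M × M}

namespace IsFactorisationMap

/-- The head already has length one, so geodesicity leaves length zero for the remainder. -/
theorem eta_of_mem (hS : IsGenerating S) (h : IsFactorisationMap S η) {f : M} (hf : f ∈ S) :
    η f = (f, 1) := by
  by_cases h1 : f = 1
  · rw [h1, h.one]
  · have h2 := h.geodesic f
    rw [h.mul_eq, len_eq_one hS hf h1, len_eq_one hS (h.mem f h1).1 (h.mem f h1).2] at h2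
    have h3 : (η f).2 = 1 := len_eq_zero hS (by omega)
    have h4 := h.mul_eq f
    rw [h3, mul_one] at h4
    exact Prod.ext h4 h3

end IsFactorisationMap

namespace IsFactorabilityStructure

/-- Test the triple `(1, ab, c)`. Here `F₂F₁F₂F₁` gives `(a, b, c)` without loss of length, so it
must agree with `F₂F₁F₂`, which consists of the head of `abc` followed by the factorisation of its
remainder. -/
theorem eta_mul_mul (hS : IsGenerating S) (h : IsFactorabilityStructure S η) {a b c : M}
    (hab : η (a * b) = (a, b)) (hbc : η (b * c) = (b, c)) :
    η (a * (b * c)) = (a, b * c) := by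
  have h1 := h.triples (1, a * b, c)
  have h2 := h.geodesic (a * b)
  rw [hab] at h2
  have hm := h.toIsFactorisationMap.eta_of_mem hS (h.fst_mem hS (a * (b * c)))
  have hm' := h.mul_eq (a * (b * c))
  simp only [triple₁, triple₂, etaMul, lenSum, one_mul, hab, hbc, mul_assoc, hm,
    len_one, h2, Prod.mk.injEq] at h1
  rcases h1 with ⟨-, h1, h3⟩ | ⟨-, -, h1⟩
  · have h4 := h.mul_eq (η (a * (b * c))).2
    rw [h3] at h4
    exact Prod.ext h1 h4.symm
  · omega

theorem splitHead_eq (hS : IsGenerating S) (h : IsFactorabilityStructure S η) {u : List S}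
    (hu : IsNormalWord hS.e (localMap hS h) u) : splitHead u = η (ev u) := by
  induction u with
  | nil => exact h.one.symm
  | cons s l ih =>
    cases l with
    | nil => simp [splitHead, h.toIsFactorisationMap.eta_of_mem hS s.2]
    | cons t l =>
      have h1 := ih hu.tail
      have h2 := (List.isChain_cons_cons.1 hu.2).1
      have h3 : η (s.1 * t.1) = (s.1, t.1) :=
        congrArg (fun p : S × S => (p.1.1, p.2.1)) h2
      have h4 := h.eta_mul_mul hS h3 (c := ev l)
        (by rw [ev_cons] at h1; exact h1.symm)
      simp only [splitHead, ev_cons] at h4 ⊢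
      exact h4.symm

theorem localMap_val (hS : IsGenerating S) (h : IsFactorabilityStructure S η) (p : S × S) :
    η (p.1.1 * p.2.1) = ((localMap hS h p).1.1, (localMap hS h p).2.1) := rfl

theorem localMap_eq_iff (hS : IsGenerating S) (h : IsFactorabilityStructure S η)
    (p q : S × S) : localMap hS h p = q ↔ η (p.1.1 * p.2.1) = (q.1.1, q.2.1) := by
  rw [h.localMap_val, Prod.ext_iff, Prod.ext_iff, Subtype.ext_iff, Subtype.ext_iff]

/-- On `(t₀, s₁, s₂)` the map `F₂F₁F₂` yields `(s₁', s₂', t₂)`. If none of these is `e`, the total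
length is three and cannot have dropped; so `F₁` fixes the result. -/
theorem weakDomino (hS : IsGenerating S) (h : IsFactorabilityStructure S η) :
    WeakDomino hS.e (localMap hS h) := by
  intro s₁ s₂ s₁' s₂' t₀ t₁ t₂ h1 h2 h3 h4 h5
  by_contra! hne
  obtain ⟨hns, hn1, hn2, hn3⟩ := hne
  simp only [ne_eq, localMap_eq_iff] at *
  have h6 := h.triples (t₀.1, s₁.1, s₂.1)
  simp only [triple₁, triple₂, etaMul, lenSum, h1, h2, h3] at h6
  rcases h6 with ⟨h6, -⟩ | ⟨-, h6, -⟩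
  · apply hns
    simp only [Prod.mk.injEq] at h6
    exact Prod.ext h6.1 h6.2.1
  · have e1 := len_eq_one hS s₁'.2 (ne_one_of_ne_e hn1)
    have e2 := len_eq_one hS s₂'.2 (ne_one_of_ne_e hn2)
    have e3 := len_eq_one hS t₂.2 (ne_one_of_ne_e hn3)
    have e4 := len_le_one t₀
    have e5 := len_le_one s₁
    have e6 := len_le_one s₂
    omega

theorem isLocalFactorability (hS : IsGenerating S) (h : IsFactorabilityStructure S η) :
    IsLocalFactorability hS (localMap hS h) where
  one_left s := by
    rw [localMap_eq_iff]
    simpa [IsGenerating.e] using h.toIsFactorisationMap.eta_of_mem hS s.2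
  idem p := by
    rw [localMap_eq_iff]
    exact congrArg η (h.mul_eq (p.1.1 * p.2.1))
  mul_eq p := h.mul_eq _
  weakDomino := h.weakDomino hS
  unique u v hu hv huv := by
    induction u generalizing v with
    | nil =>
      cases v with
      | nil => rfl
      | cons t v =>
        have h1 := h.splitHead_eq hS hv
        rw [← huv, ev_nil, h.one] at h1
        exact absurd (List.mem_cons.2 (.inl (Subtype.ext (congrArg Prod.fst h1).symm))) hv.1
    | cons s u ih =>
      cases v with
      | nil =>
        have h1 := h.splitHead_eq hS hu
        rw [huv, ev_nil, h.one] at h1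
        exact absurd (List.mem_cons.2 (.inl (Subtype.ext (congrArg Prod.fst h1).symm))) hu.1
      | cons t v =>
        have h1 := h.splitHead_eq hS hu
        rw [huv, ← h.splitHead_eq hS hv] at h1
        simp only [splitHead, Prod.mk.injEq] at h1
        rw [Subtype.ext h1.1, ih v hu.tail hv.tail h1.2]

end IsFactorabilityStructure

namespace IsLocalFactorability

variable {φ : S × S → S × S}

theorem factOfLocal_ev (h : IsLocalFactorability hS φ) (w : List S) :
    factOfLocal hS φ (ev w) = splitHead (normMap hS.e φ w) := by
  unfold factOfLocal
  split_ifs with h1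
  · rw [h.normMap_eq_of_ev_eq (u := []) ⟨by simp, by simp⟩ h1]
    rfl
  · rw [h.normMap_congr (hS.exists_word (ev w)).choose_spec]

theorem factOfLocal_ev_of_isNormalWord (h : IsLocalFactorability hS φ) {w : List S}
    (hw : IsNormalWord hS.e φ w) : factOfLocal hS φ (ev w) = splitHead w := by
  rw [h.factOfLocal_ev, h.normMap_eq_of_ev_eq hw rfl]

theorem exists_isNormalWord (h : IsLocalFactorability hS φ) (f : M) :
    ∃ w, IsNormalWord hS.e φ w ∧ ev w = f := by
  obtain ⟨w, rfl⟩ := hS.exists_word f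
  exact ⟨_, h.isNormalWord_normMap w⟩

end IsLocalFactorability

theorem IsFactorabilityStructure.factOfLocal_localMap (hS : IsGenerating S)
    (h : IsFactorabilityStructure S η) : factOfLocal hS (localMap hS h) = η := by
  have hl := h.isLocalFactorability hS
  funext f
  obtain ⟨w, hw, rfl⟩ := hl.exists_isNormalWord f
  rw [hl.factOfLocal_ev_of_isNormalWord hw, h.splitHead_eq hS hw]

end Fact

/-! ### From local data to a factorability structure -/

section Local

variable {M : Type*} [Monoid M] {S : Set M} {hS : IsGenerating S} {φ : S × S → S × S}

theorem mul_splitHead (u : List S) : (splitHead u).1 * (splitHead u).2 = ev u := by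
  cases u <;> simp [splitHead]

namespace IsLocalFactorability

/-- The pair `φ p` is a normal word of length at most two padded with `e`, and the padding evaluates
to `1`. -/
theorem factOfLocal_mul (h : IsLocalFactorability hS φ) (p : S × S) :
    factOfLocal hS φ (p.1.1 * p.2.1) = ((φ p).1.1, (φ p).2.1) := by
  have h1 : ev [(φ p).1, (φ p).2] = p.1.1 * p.2.1 := by simp [h.mul_eq]
  obtain ⟨v, k, hv, hw⟩ := exists_eq_append_replicate h.one_left
    (List.isChain_pair.2 (h.idem p) : [(φ p).1, (φ p).2].IsChain (Stable φ))
  have h2 : ev v = p.1.1 * p.2.1 := by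
    rw [← h1, hw]
    simp
  rw [← h2, h.factOfLocal_ev_of_isNormalWord hv]
  have hk : ∀ (a : S) (j : ℕ), a ∈ List.replicate j hS.e → a.1 = 1 := by
    intro a j ha
    rw [List.eq_of_mem_replicate ha]
    rfl
  match v, hw with
  | [], hw =>
    rw [List.nil_append] at hw
    have ha := hk (φ p).1 k (by rw [← hw]; simp)
    have hb := hk (φ p).2 k (by rw [← hw]; simp)
    rw [ha, hb]
    rfl
  | [s], hw =>
    simp only [List.singleton_append, List.cons.injEq] at hw
    have hb := hk (φ p).2 k (by rw [← hw.2]; simp)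
    rw [hw.1, hb]
    rfl
  | [s, t], hw =>
    simp only [List.cons_append, List.cons.injEq] at hw
    rw [hw.1, hw.2.1]
    simp [splitHead]
  | _ :: _ :: _ :: _, hw =>
    have := congrArg List.length hw
    simp only [List.length_cons, List.length_append, List.length_nil] at this
    omega

theorem isFactorisationMap (h : IsLocalFactorability hS φ) :
    IsFactorisationMap S (factOfLocal hS φ) where
  mem f hf := by
    obtain ⟨w, hw, rfl⟩ := h.exists_isNormalWord f
    rw [h.factOfLocal_ev_of_isNormalWord hw]
    cases w with
    | nil => exact absurd rfl hf
    | cons s l =>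
      exact ⟨s.2, ne_one_of_ne_e (hS := hS) fun h' => hw.1 (h' ▸ List.mem_cons_self)⟩
  mul_eq f := by
    obtain ⟨w, hw, rfl⟩ := h.exists_isNormalWord f
    rw [h.factOfLocal_ev_of_isNormalWord hw, mul_splitHead]
  geodesic f := by
    obtain ⟨w, hw, rfl⟩ := h.exists_isNormalWord f
    rw [h.factOfLocal_ev_of_isNormalWord hw, mul_splitHead]
    cases w with
    | nil => simp [splitHead, len_one]
    | cons s l =>
      have hs : s ≠ hS.e := fun h' => hw.1 (h' ▸ List.mem_cons_self)
      rw [h.len_ev hw, splitHead, h.len_ev hw.tail, len_eq_one hS s.2 (ne_one_of_ne_e hs),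
        List.length_cons, add_comm]
  one := by simp [factOfLocal]

theorem factOfLocal_mul_fst (h : IsLocalFactorability hS φ) {f a b c d : M}
    (hf : factOfLocal hS φ f = (a, b)) (hb : factOfLocal hS φ b = (c, d)) :
    factOfLocal hS φ (a * c) = (a, c) := by
  obtain ⟨w, hw, rfl⟩ := h.exists_isNormalWord f
  rw [h.factOfLocal_ev_of_isNormalWord hw] at hf
  match w, hw, hf with
  | [], _, hf =>
    cases hf
    rw [h.isFactorisationMap.one] at hb
    cases hb
    rw [mul_one, h.isFactorisationMap.one]
  | [s], _, hf =>
    cases hf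
    rw [ev_nil, h.isFactorisationMap.one] at hb
    cases hb
    rw [mul_one, h.isFactorisationMap.eta_of_mem hS s.2]
  | s :: t :: l, hw, hf =>
    cases hf
    rw [h.factOfLocal_ev_of_isNormalWord hw.tail] at hb
    cases hb
    rw [h.factOfLocal_mul (s, t), (List.isChain_cons_cons.1 hw.2).1]

/-- Multiplication by a generator on the left, in terms of the head of the second factor. -/
theorem factOfLocal_letter_mul (h : IsLocalFactorability hS φ) {s p q a b : M} (hs : s ∈ S)
    (hp : p ≠ 1) (hpq : factOfLocal hS φ (p * q) = (p, q))
    (hsp : factOfLocal hS φ (s * p) = (a, b)) (hl : len S (s * p) = 2)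
    (hb : len S (b * q) = 1 + len S q) :
    factOfLocal hS φ (s * (p * q)) = (a, b * q) ∧ len S (s * (p * q)) = 2 + len S q := by
  obtain ⟨w, hw, hpq'⟩ := h.exists_isNormalWord (p * q)
  rw [← hpq', h.factOfLocal_ev_of_isNormalWord hw] at hpq
  cases w with
  | nil => exact absurd (congrArg Prod.fst hpq).symm hp
  | cons p' l =>
    cases hpq
    have h1 := h.factOfLocal_mul (⟨s, hs⟩, p')
    simp only at h1
    rw [hsp, Prod.mk.injEq] at h1
    obtain ⟨ha, hb'⟩ := h1
    have h2 := h.len_ev hw.tail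
    have h3 := h.isFactorisationMap.geodesic (s * p'.1)
    have h4 : len S a ≤ 1 := ha ▸ len_le_one _
    have h5 : len S b ≤ 1 := hb' ▸ len_le_one _
    rw [h.isFactorisationMap.mul_eq, hl, hsp] at h3
    simp only at h3
    set r := sweep φ (⟨s, hs⟩ :: p' :: l) with hr
    have hev : ev r = s * (p' * ev l) := by
      rw [hr, sweep, ev_sweepFrom h.mul_eq, ev_cons]
    have hev' : ev (sweepFrom φ (φ (⟨s, hs⟩, p')).2 l) = b * ev l := by
      rw [ev_sweepFrom h.mul_eq, ← hb']
    have hr' : r = (φ (⟨s, hs⟩, p')).1 :: sweepFrom φ (φ (⟨s, hs⟩, p')).2 l := rfl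
    -- The head is not `e` because two lengths, each at most one, add up to two. An `e` further on
    -- could be erased, giving a word for `b * q` shorter than its length.
    have hmem : hS.e ∉ r := by
      rw [hr', List.mem_cons, not_or]
      constructor
      · intro h'
        rw [← h'] at ha
        rw [ha, show hS.e.1 = (1 : M) from rfl, len_one] at h3
        omega
      · intro h'
        have h6 := length_erase_lt h'
        have h7 := len_ev_le (erase hS.e (sweepFrom φ (φ (⟨s, hs⟩, p')).2 l))
        rw [ev_erase, hev', hb, h2] at h7
        rw [length_sweepFrom] at h6
        omega
    have hn : IsNormalWord hS.e φ r :=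
      isNormalWord_sweep h.one_left h.idem h.weakDomino hw _ hmem
    rw [← hev, h.factOfLocal_ev_of_isNormalWord hn, h.len_ev hn, h2, hr', splitHead, hev', ← ha,
      List.length_cons, length_sweepFrom]
    exact ⟨rfl, by omega⟩

/-- Appending `q` on the right does not disturb the head, provided no length is lost at the
remainder. The letters of `u` are added from right to left, each by `factOfLocal_letter_mul`. -/
theorem factOfLocal_mul_mul (h : IsLocalFactorability hS φ) (u : List S) {p q a b : M}
    (hpq : factOfLocal hS φ (p * q) = (p, q)) (hl : len S (ev u * p) = u.length + len S p)
    (hup : factOfLocal hS φ (ev u * p) = (a, b)) (hb : len S (b * q) = len S b + len S q) :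
    factOfLocal hS φ (ev u * (p * q)) = (a, b * q) ∧
      len S (ev u * (p * q)) = u.length + len S p + len S q := by
  have hη := h.isFactorisationMap
  -- A trivial head forces `q = 1`, so nothing remains to be shown.
  by_cases hp : p = 1
  · subst hp
    rw [one_mul] at hpq
    have hq : q = 1 := by
      by_contra hq
      exact (hη.mem q hq).2 (congrArg Prod.fst hpq)
    subst hq
    rw [mul_one] at hup
    rw [mul_one] at hl
    simp [hup, hl, len_one]
  have hgpq := hη.geodesic (p * q)
  rw [hη.mul_eq, hpq] at hgpq
  simp only at hgpq
  have hpS : p ∈ S := by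
    have := hη.fst_mem hS (p * q)
    rwa [hpq] at this
  have hp1 := len_eq_one hS hpS hp
  induction u generalizing a b with
  | nil =>
    rw [ev_nil, one_mul, hη.eta_of_mem hS hpS, Prod.mk.injEq] at hup
    obtain ⟨rfl, rfl⟩ := hup
    simp [hpq, hgpq]
  | cons s u ih =>
    rw [ev_cons, mul_assoc] at hl hup
    rw [List.length_cons] at hl ⊢
    have l1 := len_mul_le hS s.1 (ev u * p)
    have l2 := len_mul_le hS (ev u) p
    have l3 := len_ev_le u
    have l4 := len_le_one s
    have hu : len S (ev u * p) = u.length + len S p := by omega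
    obtain ⟨⟨a₁, b₁⟩, hab⟩ : ∃ x, factOfLocal hS φ (ev u * p) = x := ⟨_, rfl⟩
    obtain ⟨⟨c₀, c⟩, hc⟩ : ∃ x, factOfLocal hS φ (s.1 * a₁) = x := ⟨_, rfl⟩
    have hup1 : ev u * p ≠ 1 := by
      intro h'
      rw [h', len_one] at hu
      omega
    have m1 := hη.mul_eq (ev u * p)
    have g1 := hη.geodesic (ev u * p)
    have n1 := hη.mem _ hup1
    have m2 := hη.mul_eq (s.1 * a₁)
    have g2 := hη.geodesic (s.1 * a₁)
    rw [m1, hab] at g1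
    rw [hab] at m1 n1
    rw [m2, hc] at g2
    rw [hc] at m2
    simp only at m1 g1 n1 m2 g2
    have ha₁ := len_eq_one hS n1.1 n1.2
    have hc₀ : len S c₀ ≤ 1 := by
      have := len_le_one_of_mem (hη.fst_mem hS (s.1 * a₁))
      rwa [hc] at this
    have l5 := len_mul_le hS (s.1 * a₁) b₁
    have l6 := len_mul_le hS s.1 a₁
    rw [mul_assoc, m1] at l5
    -- Subadditivity is tight throughout, since `s|u|p` is geodesic: `s * a₁` loses no length, and
    -- neither does `c * b₁`.
    have hsa : len S (s.1 * a₁) = 2 := by omega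
    have l7 := len_mul_le hS c₀ (c * b₁)
    rw [← mul_assoc, m2, mul_assoc, m1] at l7
    have l8 := len_mul_le hS c b₁
    have hc1 : len S c = 1 := by
      by_cases h0 : s.1 * a₁ = 1
      · rw [h0, len_one] at hsa
        omega
      · have := hη.mem _ h0
        rw [hc] at this
        have h1 : len S c₀ = 1 := len_eq_one hS this.1 this.2
        omega
    have hcb : len S (c * b₁) = 1 + len S b₁ := by omega
    have k1 := h.factOfLocal_letter_mul s.2 n1.2 (m1.symm ▸ hab) hc hsa hcb
    rw [m1, hup, Prod.mk.injEq] at k1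
    -- Thus the given factorisation is `(c₀, c * b₁)`, and additivity for `c * b₁ * q` passes down
    -- to `b₁ * q`, as the induction hypothesis requires.
    obtain ⟨⟨rfl, rfl⟩, -⟩ := k1
    have l9 := len_mul_le hS c (b₁ * q)
    have l10 := len_mul_le hS b₁ q
    rw [← mul_assoc] at l9
    obtain ⟨i1, i2⟩ := ih hu hab (by omega)
    have m3 : ev u * (p * q) = a₁ * (b₁ * q) := by rw [← mul_assoc, ← mul_assoc, m1]
    rw [m3] at i1 i2
    have k2 := h.factOfLocal_letter_mul s.2 n1.2 i1 hc hsa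
      (by rw [← mul_assoc]; omega)
    rw [ev_cons, mul_assoc s.1, m3, mul_assoc c]
    exact ⟨k2.1, by omega⟩

theorem isFactorabilityStructure (h : IsLocalFactorability hS φ) :
    IsFactorabilityStructure S (factOfLocal hS φ) where
  toIsFactorisationMap := h.isFactorisationMap
  triples := by
    have hη := h.isFactorisationMap
    set η := factOfLocal hS φ with hη'
    have hlen : ∀ f g, len S (η (f * g)).1 + len S (η (f * g)).2 ≤ len S f + len S g := by
      intro f g
      have h1 := hη.geodesic (f * g)
      rw [hη.mul_eq] at h1
      exact h1 ▸ len_mul_le hS f g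
    have hfst : ∀ f, η ((η f).1 * (η (η f).2).1) = ((η f).1, (η (η f).2).1) := fun f =>
      h.factOfLocal_mul_fst (f := f) (b := (η f).2) (d := (η (η f).2).2) rfl rfl
    have le₁ : ∀ x, lenSum S (triple₁ (etaMul η) x) ≤ lenSum S x := by
      rintro ⟨f, g, k⟩
      have := hlen f g
      simp only [lenSum, triple₁, etaMul]
      omega
    have le₂ : ∀ x, lenSum S (triple₂ (etaMul η) x) ≤ lenSum S x := by
      rintro ⟨f, g, k⟩
      have := hlen g k
      simp only [lenSum, triple₂, etaMul]
      omega
    let m : M × M × M → M := fun x => x.1 * (x.2.1 * x.2.2)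
    have hm₁ : ∀ x, m (triple₁ (etaMul η) x) = m x := by
      rintro ⟨f, g, k⟩
      simp only [m, triple₁, etaMul]
      rw [← mul_assoc, hη.mul_eq, mul_assoc]
    have hm₂ : ∀ x, m (triple₂ (etaMul η) x) = m x := by
      rintro ⟨f, g, k⟩
      simp only [m, triple₂, etaMul, hη.mul_eq]
    have hle : ∀ x, len S (m x) ≤ lenSum S x := by
      rintro ⟨f, g, k⟩
      have h1 := len_mul_le hS f (g * k)
      have h2 := len_mul_le hS g k
      simp only [m, lenSum]
      omega
    -- a triple whose length is preserved by `F₂F₁F₂` is geodesic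
    have key : ∀ x, lenSum S x ≤ lenSum S (triple₂ (etaMul η) (triple₁ (etaMul η)
        (triple₂ (etaMul η) x))) → len S (m x) = lenSum S x ∧
        triple₂ (etaMul η) (triple₁ (etaMul η) (triple₂ (etaMul η) x)) =
          ((η (m x)).1, η (η (m x)).2) := by
      rintro ⟨f, g, k⟩ hx
      obtain ⟨⟨p, q⟩, hpq⟩ : ∃ y, η (g * k) = y := ⟨_, rfl⟩
      obtain ⟨⟨a, b⟩, hab⟩ : ∃ y, η (f * p) = y := ⟨_, rfl⟩
      have m1 := hη.mul_eq (g * k)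
      have g1 := hη.geodesic (f * p)
      have g2 := hη.geodesic (b * q)
      rw [hη.mul_eq, hab] at g1
      rw [hη.mul_eq] at g2
      rw [hpq] at m1
      simp only [lenSum, triple₁, triple₂, etaMul, hpq, hab, m] at hx g1 m1 ⊢
      have l1 := hlen g k
      rw [hpq] at l1
      have l2 := len_mul_le hS f p
      have l3 := len_mul_le hS b q
      simp only at l1
      obtain ⟨u, rfl, hu⟩ := exists_word_len hS f
      obtain ⟨i1, i2⟩ := h.factOfLocal_mul_mul u (q := q) (by rw [m1]; exact hpq)
        (by omega) hab (by omega)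
      rw [← hη', m1] at i1
      rw [m1] at i2
      rw [i1, i2]
      exact ⟨by omega, rfl⟩
    -- Conversely, a geodesic triple cannot be shortened, because the maps preserve its product.
    have key' : ∀ x, len S (m x) = lenSum S x →
        triple₂ (etaMul η) (triple₁ (etaMul η) (triple₂ (etaMul η) x)) =
          ((η (m x)).1, η (η (m x)).2) := by
      intro x hx
      refine (key x ?_).2
      have h1 := hle (triple₂ (etaMul η) (triple₁ (etaMul η) (triple₂ (etaMul η) x)))
      rw [hm₂, hm₁, hm₂] at h1
      omega
    intro x F₁ F₂
    have h1 : lenSum S (F₁ x) ≤ lenSum S x := le₁ x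
    have h2 := hle (F₁ x)
    rw [hm₁] at h2
    by_cases hx : len S (m x) = lenSum S x
    · left
      have e1 : F₂ (F₁ (F₂ x)) = _ := key' x hx
      have e2 : F₂ (F₁ (F₂ (F₁ x))) = _ := key' (F₁ x) (by rw [hm₁]; omega)
      rw [hm₁] at e2
      rw [e2, e1]
      refine ⟨?_, rfl⟩
      simp only [F₁, triple₁, etaMul]
      -- Two successive heads form a stable pair, so another `F₁` changes nothing.
      rw [hfst]
    · right
      have h3 := hle x
      have h4 : lenSum S (F₂ (F₁ (F₂ x))) < lenSum S x := by
        by_contra! h'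
        exact hx (key x h').1
      refine ⟨(le₁ _).trans_lt h4, h4, ?_⟩
      -- If the length survives, `F₁ x` is geodesic and as long as `x`; having the same product, `x`
      -- would be geodesic too.
      by_contra! h'
      have h5 := (key (F₁ x) (h1.trans h')).1
      rw [hm₁] at h5
      have h6 := (le₂ _).trans ((le₁ _).trans (le₂ (F₁ x)))
      have h7 : lenSum S x ≤ lenSum S (F₁ x) := h'.trans h6
      omega

theorem localMap_factOfLocal (h : IsLocalFactorability hS φ) :
    localMap hS h.isFactorabilityStructure = φ := by
  funext p
  rw [IsFactorabilityStructure.localMap_eq_iff, h.factOfLocal_mul]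

end IsLocalFactorability

end Local

/-! ### Removing and restoring the letter `e` -/

section Proj

variable {A : Type*} {e : A}

theorem proj_append (u v : List A) : proj e (u ++ v) = proj e u ++ proj e v := by
  simp [proj]

theorem proj_replicate (k : ℕ) : proj e (List.replicate k e) = [] := by
  simp [proj]

theorem proj_incl (x : List (Plus e)) : proj e (incl x) = x := by
  induction x with
  | nil => rfl
  | cons a x ih =>
    have : proj e (incl (a :: x)) = a :: proj e (incl x) := by
      simp [proj, incl, a.2]
    rw [this, ih]

theorem incl_proj (w : List A) : incl (proj e w) = erase e w := by
  induction w with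
  | nil => rfl
  | cons a w ih =>
    by_cases ha : a = e
    · subst ha
      rw [erase_cons_self, ← ih]
      simp [proj]
    · rw [erase_cons_of_ne ha, ← ih]
      simp [proj, incl, ha]

theorem incl_append (x y : List (Plus e)) : incl (x ++ y) = incl x ++ incl y := by
  simp [incl]

theorem length_incl (x : List (Plus e)) : (incl x).length = x.length := by
  simp [incl]

theorem erase_incl (x : List (Plus e)) : erase e (incl x) = incl x := by
  rw [← incl_proj, proj_incl]

theorem eq_proj_iff (v : List (Plus e)) (w : List A) : v = proj e w ↔ incl v = erase e w := by
  rw [← incl_proj]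
  exact ⟨congrArg incl, fun h => by rw [← proj_incl v, h, proj_incl]⟩

theorem length_proj (w : List A) : (proj e w).length = (erase e w).length := by
  rw [← incl_proj, length_incl]

end Proj

/-! ### Comparison of normal forms and rewriting systems -/

section Rules

theorem foldl_expandAt_map_succ {M : Type*} (η : M → M × M) (l : List ℕ) (f : M) (v : List M) :
    (l.map Nat.succ).foldl (fun w i => expandAt η i w) (f :: v) =
      f :: l.foldl (fun w i => expandAt η i w) v := by
  induction l generalizing v with
  | nil => rfl
  | cons i l ih => exact ih (expandAt η i v)

variable {M : Type*} [Monoid M] {S : Set M} {hS : IsGenerating S} {φ : S × S → S × S}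

namespace IsLocalFactorability

theorem erase_extNormMap (h : IsLocalFactorability hS φ) (w : List S) :
    erase hS.e (extNormMap hS.e φ w) = normMap hS.e φ w :=
  erase_append_replicate (h.isNormalWord_normMap w).1.1 _

theorem extNormMap_one_left (h : IsLocalFactorability hS φ) (s : S) :
    extNormMap hS.e φ [hS.e, s] = [s, hS.e] := by
  rw [h.extNormMap_pair (hS.e, s), h.one_left]

theorem quadRules_iff (h : IsLocalFactorability hS φ) (u v : List S) :
    quadRules (extNormMap hS.e φ) u v ↔
      (∃ s : Plus hS.e, u = [hS.e, s.1] ∧ v = [s.1, hS.e]) ∨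
      (∃ u' v' : List (Plus hS.e), quadRulesMod hS.e (extNormMap hS.e φ) u' v' ∧ u = incl u' ∧
        v = incl v' ++ List.replicate (u'.length - v'.length) hS.e) := by
  -- Values on length-two words are `e`-free words padded to length two, so they can be recovered
  -- from their projections.
  have key : ∀ s t : S, extNormMap hS.e φ [s, t] =
      incl (proj hS.e (extNormMap hS.e φ [s, t])) ++
        List.replicate (2 - (proj hS.e (extNormMap hS.e φ [s, t])).length) hS.e := by
    intro s t
    rw [incl_proj, length_proj, h.erase_extNormMap]
    rfl
  constructor
  · rintro ⟨s, t, rfl, hst, rfl⟩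
    by_cases hs : s = hS.e
    · subst hs
      have ht : t ≠ hS.e := by
        rintro rfl
        exact hst (h.extNormMap_one_left _)
      exact Or.inl ⟨⟨t, ht⟩, rfl, h.extNormMap_one_left t⟩
    · have ht : t ≠ hS.e := by
        rintro rfl
        apply hst
        rw [h.extNormMap_pair (s, hS.e), h.one_right]
      exact Or.inr ⟨_, _, ⟨⟨s, hs⟩, ⟨t, ht⟩, rfl, hst, rfl⟩, rfl, key s t⟩
  · rintro (⟨s, rfl, rfl⟩ | ⟨_, _, ⟨s, t, rfl, hst, rfl⟩, rfl, rfl⟩)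
    · refine ⟨hS.e, s.1, rfl, ?_, (h.extNormMap_one_left _).symm⟩
      rw [h.extNormMap_one_left]
      intro h'
      exact s.2 (List.cons.inj h').1
    · exact ⟨s.1, t.1, rfl, hst, (key s.1 t.1).symm⟩

theorem proj_eq_or_step (h : IsLocalFactorability hS φ) {x y : List S}
    (hxy : Step (quadRules (extNormMap hS.e φ)) x y) :
    proj hS.e x = proj hS.e y ∨
      Step (quadRulesMod hS.e (extNormMap hS.e φ)) (proj hS.e x) (proj hS.e y) := by
  obtain ⟨w, w', u, v, huv, rfl, rfl⟩ := hxy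
  rcases (h.quadRules_iff u v).1 huv with ⟨s, rfl, rfl⟩ | ⟨u', v', h', rfl, rfl⟩
  · left
    have h1 : proj hS.e [s.1, hS.e] = proj hS.e [hS.e, s.1] := by
      simp [proj, s.2]
    rw [proj_append, proj_append, proj_append, proj_append, h1]
  · right
    refine ⟨proj hS.e w, proj hS.e w', u', v', h', ?_, ?_⟩
    · simp only [proj_append, proj_incl]
    · simp only [proj_append, proj_incl, proj_replicate, List.append_nil]

/-- A step that shortens the word leaves letters `e` in its middle; the rules `e|s → s|e` push them
into the padding. The length bound is carried along to add up paddings under truncated subtraction.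
-/
theorem rewrites_incl (h : IsLocalFactorability hS φ) {x y : List (Plus hS.e)}
    (hxy : Rewrites (quadRulesMod hS.e (extNormMap hS.e φ)) x y) :
    y.length ≤ x.length ∧ Rewrites (quadRules (extNormMap hS.e φ)) (incl x)
      (incl y ++ List.replicate (x.length - y.length) hS.e) := by
  induction hxy with
  | refl =>
    rw [Nat.sub_self, List.replicate_zero, List.append_nil]
    exact ⟨le_rfl, .refl⟩
  | @tail y z _ hyz ih =>
    obtain ⟨ih1, ih2⟩ := ih
    obtain ⟨w, w', u, v, huv, rfl, rfl⟩ := hyz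
    have hl : v.length ≤ u.length := by
      obtain ⟨s, t, rfl, -, rfl⟩ := huv
      rw [length_proj, h.erase_extNormMap]
      exact length_normMap_le _ _ _
    have hR : ∀ s, s ≠ hS.e → quadRules (extNormMap hS.e φ) [hS.e, s] [s, hS.e] :=
      fun s hs => (h.quadRules_iff _ _).2 (.inl ⟨⟨s, hs⟩, rfl, rfl⟩)
    have h1 : Rewrites (quadRules (extNormMap hS.e φ)) (incl u)
        (incl v ++ List.replicate (u.length - v.length) hS.e) :=
      .of_rule ((h.quadRules_iff _ _).2 (.inr ⟨u, v, huv, rfl, rfl⟩))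
    have h2 := (h1.append_left (incl w)).append_right (incl w')
    have h3 := rewrites_erase_append_replicate hR
      (incl w ++ (incl v ++ List.replicate (u.length - v.length) hS.e) ++ incl w')
    simp only [erase_append, erase_incl, erase_replicate, List.append_nil, ← incl_append,
      List.length_append, length_incl, List.length_replicate] at h1 h2 h3 ih1 ih2 ⊢
    have h4 := ih2.trans ((h2.trans h3).append_right _)
    refine ⟨by omega, ?_⟩
    rw [List.append_assoc, List.replicate_append_replicate] at h4
    convert h4 using 3
    omega

/-- The backward direction projects step by step. It needs no length bound, since `proj` discards
any amount of padding. -/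
theorem rewrites_iff (h : IsLocalFactorability hS φ) (x y : List (Plus hS.e)) :
    Rewrites (quadRulesMod hS.e (extNormMap hS.e φ)) x y ↔
      Rewrites (quadRules (extNormMap hS.e φ)) (incl x)
        (incl y ++ List.replicate (x.length - y.length) hS.e) := by
  refine ⟨fun hxy => (h.rewrites_incl hxy).2, fun hxy => ?_⟩
  have key : ∀ u v, Rewrites (quadRules (extNormMap hS.e φ)) u v →
      Rewrites (quadRulesMod hS.e (extNormMap hS.e φ)) (proj hS.e u) (proj hS.e v) := by
    intro u v huv
    induction huv with
    | refl => exact .refl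
    | tail _ hs ih =>
      rcases h.proj_eq_or_step hs with h' | h'
      · exact h' ▸ ih
      · exact ih.trans (.single h')
  have h1 := key _ _ hxy
  rwa [proj_append, proj_incl, proj_incl, proj_replicate, List.append_nil] at h1

end IsLocalFactorability

open Classical in
theorem map_erase (hS : IsGenerating S) (w : List S) :
    (erase hS.e w).map Subtype.val = (w.map Subtype.val).filter (fun x => x ≠ 1) := by
  induction w with
  | nil => rfl
  | cons a w ih =>
    by_cases ha : a = hS.e
    · subst ha
      rw [erase_cons_self, ih]
      simp [IsGenerating.e]
    · rw [erase_cons_of_ne ha, List.map_cons, ih]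
      simp [ne_one_of_ne_e ha]

namespace IsFactorabilityStructure

variable {η : M → M × M}

/-- By `splitHead_eq`, each expansion of the last entry peels one letter off the normal word; its
length is `len S (ev u)`, so the expansions stop exactly at the last letter. -/
theorem nfFact_ev (hS : IsGenerating S) (h : IsFactorabilityStructure S η) {u : List S}
    (hu : IsNormalWord hS.e (localMap hS h) u) : nfFact S η (ev u) = u.map Subtype.val := by
  have hl := h.isLocalFactorability hS
  have hlen := hl.len_ev hu
  cases u with
  | nil => simp [nfFact]
  | cons s l =>
    have h1 : ev (s :: l) ≠ 1 := by
      intro h'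
      rw [h', len_one] at hlen
      exact absurd hlen (by simp)
    rw [nfFact, if_neg h1, hlen, List.length_cons, Nat.add_sub_cancel]
    clear h1 hlen
    induction l generalizing s with
    | nil => simp
    | cons t l ih =>
      rw [List.length_cons, List.range_succ_eq_map, List.foldl_cons]
      have h2 : expandAt η 0 [ev (s :: t :: l)] = [s.1, ev (t :: l)] := by
        simp only [expandAt, ← h.splitHead_eq hS hu, splitHead]
      rw [h2, foldl_expandAt_map_succ, ih t hu.tail]
      rfl

theorem nfFact_eq_map_proj (hS : IsGenerating S) (h : IsFactorabilityStructure S η)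
    (w : List S) :
    nfFact S η (ev w) = (proj hS.e (normOfFact hS h w)).map (fun a => a.1.1) := by
  have hl := h.isLocalFactorability hS
  have h1 : (proj hS.e (normOfFact hS h w)).map (fun a => a.1.1) =
      (incl (proj hS.e (normOfFact hS h w))).map Subtype.val := by
    simp [incl]
  rw [h1, incl_proj, normOfFact, hl.erase_extNormMap]
  obtain ⟨h2, h3⟩ := hl.isNormalWord_normMap w
  rw [← h3, h.nfFact_ev hS h2]

theorem factRules_eq (hS : IsGenerating S) (h : IsFactorabilityStructure S η) :
    factRules hS η = quadRulesMod hS.e (normOfFact hS h) := by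
  have hl := h.isLocalFactorability hS
  funext u v
  refine propext (exists_congr fun s => exists_congr fun t => and_congr_right fun _ => ?_)
  have hN : normOfFact hS h [s.1, t.1] =
      [(localMap hS h (s.1, t.1)).1, (localMap hS h (s.1, t.1)).2] :=
    hl.extNormMap_pair (s.1, t.1)
  refine and_congr (not_congr ?_) ?_
  · rw [hN]
    rw [etaMul, h.localMap_val hS (s.1, t.1)]
    simp [Subtype.ext_iff]
  · rw [eq_proj_iff, hN]
    have h1 : v.map (fun a => a.1.1) = (incl v).map Subtype.val := by simp [incl]
    rw [h1, ← (List.map_injective_iff.2 Subtype.val_injective).eq_iff, map_erase]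
    rfl

end IsFactorabilityStructure

end Rules

end FactNorm

theorem mainTheorem7 {M : Type*} [Monoid M] (S : Set M) (hS : FactNorm.IsGenerating S) :
    ∃ Φ : {η : M → M × M // FactNorm.IsFactorabilityStructure S η} ≃
        {N : List S → List S // FactNorm.IsQuadNormMod hS N ∧
          FactNorm.WeakDomino hS.e (FactNorm.restrictTwo N)},
      -- the two passages are the constructions described, and they are mutually inverse
      (∀ η, (Φ η).1 = FactNorm.normOfFact hS η.2) ∧
      (∀ N, (Φ.symm N).1 = FactNorm.factOfNorm hS N.1) ∧
      -- the map obtained from a normalisation does not depend on the representing words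
      (∀ N, ∀ w : List S, (Φ.symm N).1 (FactNorm.ev w) =
        FactNorm.splitHead (FactNorm.normMap hS.e (FactNorm.restrictTwo N.1) w)) ∧
      -- the normal forms coincide
      (∀ η, ∀ w : List S, FactNorm.nfFact S η.1 (FactNorm.ev w) =
        (FactNorm.proj hS.e ((Φ η).1 w)).map (fun a => a.1.1)) ∧
      -- the rewriting systems on `S₊` coincide
      (∀ η, FactNorm.factRules hS η.1 = FactNorm.quadRulesMod hS.e (Φ η).1) ∧
      -- the length-preserving system has the same rules, with dummy letters `e` added
      (∀ η, ∀ u v : List S, FactNorm.quadRules (Φ η).1 u v ↔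
        (∃ s : FactNorm.Plus hS.e, u = [hS.e, s.1] ∧ v = [s.1, hS.e]) ∨
        (∃ u' v' : List (FactNorm.Plus hS.e), FactNorm.factRules hS η.1 u' v' ∧
          u = FactNorm.incl u' ∧
          v = FactNorm.incl v' ++ List.replicate (u'.length - v'.length) hS.e)) ∧
      -- hence the two systems simulate each other up to the letters `e`
      (∀ η, ∀ x y : List S, FactNorm.Step (FactNorm.quadRules (Φ η).1) x y →
        FactNorm.proj hS.e x = FactNorm.proj hS.e y ∨
        FactNorm.Step (FactNorm.factRules hS η.1)
          (FactNorm.proj hS.e x) (FactNorm.proj hS.e y)) ∧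
      (∀ η, ∀ x y : List (FactNorm.Plus hS.e),
        FactNorm.Rewrites (FactNorm.factRules hS η.1) x y ↔
        FactNorm.Rewrites (FactNorm.quadRules (Φ η).1) (FactNorm.incl x)
          (FactNorm.incl y ++ List.replicate (x.length - y.length) hS.e)) := by
  refine ⟨
    { toFun := fun η => ⟨FactNorm.normOfFact hS η.2,
        (η.2.isLocalFactorability hS).isQuadNormMod, by
          rw [FactNorm.normOfFact, (η.2.isLocalFactorability hS).restrictTwo_extNormMap]
          exact η.2.weakDomino hS⟩
      invFun := fun N => ⟨FactNorm.factOfNorm hS N.1,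
        (N.2.1.isLocalFactorability N.2.2).isFactorabilityStructure⟩
      left_inv := fun η => Subtype.ext <| by
        change FactNorm.factOfLocal hS (FactNorm.restrictTwo (FactNorm.extNormMap _ _)) = _
        rw [(η.2.isLocalFactorability hS).restrictTwo_extNormMap]
        exact η.2.factOfLocal_localMap hS
      right_inv := fun N => Subtype.ext <| by
        change FactNorm.extNormMap hS.e (FactNorm.localMap hS
          (N.2.1.isLocalFactorability N.2.2).isFactorabilityStructure) = _
        rw [(N.2.1.isLocalFactorability N.2.2).localMap_factOfLocal]
        exact N.2.1.extNormMap_restrictTwo N.2.2 },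
    fun _ => rfl, fun _ => rfl,
    fun N w => (N.2.1.isLocalFactorability N.2.2).factOfLocal_ev w,
    fun η w => η.2.nfFact_eq_map_proj hS w,
    fun η => η.2.factRules_eq hS, fun η u v => ?_, fun η x y hxy => ?_, fun η x y => ?_⟩
  · rw [η.2.factRules_eq hS]
    exact (η.2.isLocalFactorability hS).quadRules_iff u v
  · rw [η.2.factRules_eq hS]
    exact (η.2.isLocalFactorability hS).proj_eq_or_step hxy
  · rw [η.2.factRules_eq hS]
    exact (η.2.isLocalFactorability hS).rewrites_iff x y
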